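/- Let $\mathbb{G}_1=\mathbb{Z}_2^\times$ be the Morava stabilizer group of height $1$ at the prime $p=2$, with its $2$-adic topology, and let $E_*=\mathbb{Z}_2[u^{\pm1}]$, $|u|=-2$, be the coefficient ring of height $1$ Morava $E$-theory. The group $\mathbb{G}_1$ acts on $E_*$ by $\mathbb{Z}_2$-algebra automorphisms, $a\in\mathbb{Z}_2^\times$ sending $u$ to $a^{-1}u$; so $a$ acts on $E_{2n}=\mathbb{Z}_2u^{-n}$ as multiplication by $a^n$. Each homogeneous component $E_t$ ($t\in\mathbb{Z}$) carries the $2$-adic topology. For $s\ge 0$ let $H^s_c(\mathbb{G}_1,E_t)$ be continuous group cohomology, i.e. the $s$-th cohomology of the complex $C^k=\{\text{continuous maps }\mathbb{G}_1^k\to E_t\}$ with $$(df)(g_1,\dots,g_{k+1})=g_1f(g_2,\dots,g_{k+1})+\sum_{j=1}^k(-1)^jf(g_1,\dots,g_jg_{j+1},\dots,g_{k+1})+(-1)^{k+1}f(g_1,\dots,g_k).$$ **Theorem 6.4.** Let $p=2$. Then for all integers $s\ge 0$ and $t$, $$H^s_c(\mathbb{G}_1,E_t)\cong\begin{cases}\mathbb{Z}_2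 & t=0,\ s=0,1,\\ \mathbb{Z}/2^{k+2} & s=1,\ t=2^{k+1}m \text{ with } k\ge 1 \text{ and } m \text{ odd},\\ \mathbb{Z}/2 & s=1,\ t=4t'+2 \text{ with } t'\in\mathbb{Z},\\ \mathbb{Z}/2 & s\ge 2,\ t \text{ even},\\ 0 & \text{otherwise.}\end{cases}$$ Here the isomorphisms are of abelian groups, and of $\mathbb{Z}_2$-modules in the first case. -/

import Mathlib

open CategoryTheory LaurentPolynomial Topology

noncomputable section

section ContinuousCohomology

universe u

variable {k G M : Type u} [CommRing k] [Group G] [TopologicalSpace G] [IsTopologicalGroup G]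
  [AddCommGroup M] [Module k M] [TopologicalSpace M] [IsTopologicalAddGroup M]
  [ContinuousConstSMul k M]

/-- The face maps `Gⁿ⁺¹ → Gⁿ` are continuous. -/
theorem continuous_contractNth (n : ℕ) (j : Fin (n + 1)) :
    Continuous (fun g : Fin (n + 1) → G => Fin.contractNth j (· * ·) g) := by
  refine continuous_pi fun i => ?_
  unfold Fin.contractNth
  split_ifs <;> fun_prop

/-- The differential `C(Gⁿ, M) → C(Gⁿ⁺¹, M)` of continuous inhomogeneous cochains:
`(df)(g₀,…,gₙ) = g₀ f(g₁,…,gₙ) + ∑_{j<n} (-1)^{j+1} f(g₀,…,gⱼgⱼ₊₁,…,gₙ) + (-1)^{n+1} f(g₀,…,gₙ₋₁)`.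
(For `j = n`, `Fin.contractNth j` drops the last entry.) -/
def contD (ρ : Representation k G M) (hρ : Continuous fun p : G × M => ρ p.1 p.2) (n : ℕ) :
    C(Fin n → G, M) →ₗ[k] C(Fin (n + 1) → G, M) where
  toFun f :=
    { toFun := fun g => ρ (g 0) (f fun i => g i.succ) +
        ∑ j : Fin (n + 1), (-1 : k) ^ ((j : ℕ) + 1) • f (Fin.contractNth j (· * ·) g)
      continuous_toFun := by
        refine Continuous.add ?_ ?_
        · exact hρ.comp (Continuous.prodMk (continuous_apply 0)
            (f.continuous.comp (continuous_pi fun i => continuous_apply i.succ)))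
        · exact continuous_finsetSum _ fun j _ =>
            (f.continuous.comp (continuous_contractNth n j)).const_smul _ }
  map_add' f f' := by
    ext g
    simp [Finset.sum_add_distrib, add_add_add_comm]
  map_smul' r f := by
    ext g
    simp [Finset.smul_sum, smul_smul, mul_comm r]

theorem contD_comp_contD (ρ : Representation k G M)
    (hρ : Continuous fun p : G × M => ρ p.1 p.2) (n : ℕ) :
    contD ρ hρ (n + 1) ∘ₗ contD ρ hρ n = 0 := by
  ext f g
  have h := groupCohomology.inhomogeneousCochains.d_comp_d (A := Rep.of ρ) (n := n)
  have h2 := congrFun (congrArg (fun φ => φ.hom (f : (Fin n → G) → M)) h) g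
  exact h2

/-- The complex of continuous inhomogeneous cochains `C(G⁰, M) → C(G¹, M) → C(G², M) → ⋯` of a
topological group `G` with coefficients in a topological `k`-module `M` with continuous linear
`G`-action. -/
def contCochains (ρ : Representation k G M) (hρ : Continuous fun p : G × M => ρ p.1 p.2) :
    CochainComplex (ModuleCat.{u} k) ℕ :=
  CochainComplex.of (fun n => ModuleCat.of k C(Fin n → G, M))
    (fun n => ModuleCat.ofHom (contD ρ hρ n)) fun n => by
      rw [← ModuleCat.ofHom_comp, contD_comp_contD]
      rfl

/-- Continuous group cohomology `H^s_c(G, M)`. -/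
def contCohomology (ρ : Representation k G M) (hρ : Continuous fun p : G × M => ρ p.1 p.2)
    (s : ℕ) : ModuleCat.{u} k :=
  (contCochains ρ hρ).homology s

end ContinuousCohomology

section MoravaE

/-- The height one Morava stabilizer group at the prime `2`, `𝔾₁ = ℤ₂ˣ`, with its usual topology:
`a` corresponds to the automorphism `(1 + X)^a - 1` of the multiplicative formal group. -/
abbrev MoravaG : Type := ℤ_[2]ˣ

/-- The coefficient ring `E_* = ℤ₂[u, u⁻¹]` of height one Morava `E`-theory at the prime `2`, with
`u = T 1`. -/
abbrev MoravaERing : Type := ℤ_[2][T;T⁻¹]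

/-- The unit `a⁻¹ u` of `E_*`. -/
def moravaActU (a : MoravaG) : MoravaERingˣ :=
  Units.map (C : ℤ_[2] →+* MoravaERing).toMonoidHom a⁻¹ *
    ⟨T 1, T (-1), by rw [← T_add]; rfl, by rw [← T_add]; rfl⟩

/-- The action of `a ∈ ℤ₂ˣ` on `E_*`: the `ℤ₂`-algebra map with `u ↦ a⁻¹ u`. In degree `2n`, which
is spanned by `u⁻ⁿ`, it is multiplication by `aⁿ` (the Adams operation `ψᵃ`). -/
def moravaAct (a : MoravaG) : MoravaERing →ₐ[ℤ_[2]] MoravaERing :=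
  AddMonoidAlgebra.lift ℤ_[2] MoravaERing ℤ
    ((Units.coeHom MoravaERing).comp (zpowersHom _ (moravaActU a)))

theorem moravaActU_zpow (a : MoravaG) (i : ℤ) :
    ((moravaActU a ^ i : MoravaERingˣ) : MoravaERing) =
      C ((a ^ (-i) : MoravaG) : ℤ_[2]) * T i := by
  have h1 : ∀ j : ℤ, (((⟨T 1, T (-1), by rw [← T_add]; rfl, by rw [← T_add]; rfl⟩ :
      MoravaERingˣ) ^ j : MoravaERingˣ) : MoravaERing) = T j := by
    intro j
    obtain ⟨n, rfl | rfl⟩ := j.eq_nat_or_neg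
    · simp [zpow_natCast, T_pow]
    · rw [zpow_neg, zpow_natCast, ← inv_pow]
      simp [Units.inv_mk, T_pow]
  rw [moravaActU, mul_zpow, Units.val_mul, h1, ← map_zpow, inv_zpow']
  rfl

theorem moravaAct_coeff (a : MoravaG) (f : MoravaERing) (i : ℤ) :
    (moravaAct a f).coeff i = ((a ^ (-i) : MoravaG) : ℤ_[2]) * f.coeff i := by
  induction f using LaurentPolynomial.induction_on' with
  | add p q hp hq => simp [hp, hq, mul_add]
  | C_mul_T n r =>
    have : moravaAct a (C r * T n) = C (r * ((a ^ (-n) : MoravaG) : ℤ_[2])) * T n := by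
      rw [← single_eq_C_mul_T, moravaAct, AddMonoidAlgebra.lift_single]
      simp only [MonoidHom.comp_apply, Units.coeHom_apply, zpowersHom_apply, toAdd_ofAdd]
      rw [moravaActU_zpow, smul_eq_C_mul, ← mul_assoc, ← map_mul]
    rw [this, ← single_eq_C_mul_T, ← single_eq_C_mul_T]
    simp only [AddMonoidAlgebra.coeff_single, Finsupp.single_apply]
    split_ifs with h
    · subst h; ring
    · simp

/-- `E_t`, the homogeneous part of degree `t` of `E_* = ℤ₂[u, u⁻¹]`, where `u` has degree `-2`. -/
def MoravaE (t : ℤ) : Submodule ℤ_[2] MoravaERing where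
  carrier := {f | ∀ i : ℤ, f.coeff i ≠ 0 → -2 * i = t}
  zero_mem' := by intro i hi; simp at hi
  add_mem' := by
    intro f g hf hg i hi
    by_cases h : f.coeff i = 0
    · exact hg i fun h' => hi (by simp [h, h'])
    · exact hf i h
  smul_mem' := by
    intro r f hf i hi
    exact hf i fun h => hi (by simp [h])

/-- The action of `𝔾₁ = ℤ₂ˣ` on `E_t`, restricted from the action on `E_*`. -/
def moravaRep (t : ℤ) : Representation ℤ_[2] MoravaG (MoravaE t) where
  toFun a := (moravaAct a).toLinearMap.restrict (p := MoravaE t) (q := MoravaE t) (by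
    intro f hf i hi
    refine hf i fun h => hi ?_
    simp [moravaAct_coeff, h])
  map_one' := by
    ext f : 2
    refine LaurentPolynomial.ext fun i => ?_
    change (moravaAct 1 f.1).coeff i = f.1.coeff i
    simp [moravaAct_coeff]
  map_mul' a b := by
    ext f : 2
    refine LaurentPolynomial.ext fun i => ?_
    change (moravaAct (a * b) f.1).coeff i = (moravaAct a (moravaAct b f.1)).coeff i
    simp only [moravaAct_coeff, mul_zpow, Units.val_mul, mul_assoc]

/-- `E_t` carries the `𝔪`-adic topology, where `𝔪` is the maximal ideal of `E_0 = ℤ₂`. -/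
instance MoravaE.instTopologicalSpace (t : ℤ) : TopologicalSpace (MoravaE t) :=
  (IsLocalRing.maximalIdeal ℤ_[2]).adicModuleTopology (MoravaE t)

theorem padicInt_isAdic : IsAdic (IsLocalRing.maximalIdeal ℤ_[2]) := by
  rw [isAdic_iff]
  have hset : ∀ n : ℕ, (((IsLocalRing.maximalIdeal ℤ_[2]) ^ n : Ideal ℤ_[2]) : Set ℤ_[2]) =
      Metric.closedBall 0 ((2 : ℝ) ^ (-n : ℤ)) := by
    intro n
    ext x
    have h := PadicInt.norm_le_pow_iff_mem_span_pow (p := 2) x n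
    rw [PadicInt.maximalIdeal_eq_span_p, Ideal.span_singleton_pow, SetLike.mem_coe, ← h]
    simp
  refine ⟨fun n => ?_, fun s hs => ?_⟩
  · rw [hset]
    exact IsUltrametricDist.isOpen_closedBall _ (by positivity)
  · obtain ⟨ε, hε, hs⟩ := Metric.mem_nhds_iff.1 hs
    obtain ⟨n, hn⟩ := PadicInt.exists_pow_neg_lt 2 hε
    refine ⟨n, subset_trans ?_ hs⟩
    rw [hset]
    refine Metric.closedBall_subset_ball ?_
    simpa using hn

instance MoravaE.instIsTopologicalAddGroup (t : ℤ) : IsTopologicalAddGroup (MoravaE t) :=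
  AddGroupFilterBasis.isTopologicalAddGroup _

instance MoravaE.instContinuousSMul (t : ℤ) : ContinuousSMul ℤ_[2] (MoravaE t) := by
  have h := @ModuleFilterBasis.continuousSMul ℤ_[2] (MoravaE t) _
    (IsLocalRing.maximalIdeal ℤ_[2]).adicTopology _ _
    ((IsLocalRing.maximalIdeal ℤ_[2]).ringFilterBasis.moduleFilterBasis
      ((IsLocalRing.maximalIdeal ℤ_[2]).adic_module_basis (MoravaE t)))
    (RingFilterBasis.isTopologicalRing _)
  have e : (inferInstance : TopologicalSpace ℤ_[2]) =
    (IsLocalRing.maximalIdeal ℤ_[2]).adicTopology := padicInt_isAdic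
  have h' : @ContinuousSMul ℤ_[2] (MoravaE t) _ (IsLocalRing.maximalIdeal ℤ_[2]).adicTopology
    (MoravaE.instTopologicalSpace t) := h
  rw [← e] at h'
  exact h'

theorem moravaRep_apply (t : ℤ) (a : MoravaG) (x : MoravaE t) :
    moravaRep t a x = ((a ^ (t / 2) : MoravaG) : ℤ_[2]) • x := by
  refine Subtype.ext (LaurentPolynomial.ext fun i => ?_)
  change (moravaAct a x.1).coeff i = _
  rw [moravaAct_coeff]
  by_cases h : x.1.coeff i = 0
  · simp [h]
  · have := x.2 i h
    have hi : t / 2 = -i := by omega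
    simp [hi]

theorem moravaRep_continuous (t : ℤ) :
    Continuous fun p : MoravaG × MoravaE t => moravaRep t p.1 p.2 := by
  simp only [moravaRep_apply]
  exact (Units.continuous_val.comp (continuous_fst.zpow _)).smul continuous_snd

/-- `H^s_c(𝔾₁, E_t)` at the prime `2`, as a `ℤ₂`-module. -/
def MoravaHc (s : ℕ) (t : ℤ) : ModuleCat ℤ_[2] :=
  contCohomology (moravaRep t) (moravaRep_continuous t) s

end MoravaE

end

/-! Every unit of ℤ₂ is uniquely ±5ˣ with x in ℤ₂ (`unitsEquiv`), so the group is G = {±1} × ℤ₂,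
topologically generated by τ = -1 and γ = 5. E_t vanishes for odd t, and E_{2n} is ℤ₂ with a acting
by aⁿ, so everything reduces to the cohomology of a continuous character ψ of G.

A crossed homomorphism is determined by its values at τ and γ, which are constrained by τ² = 1 and
τγ = γτ. If ψ(τ) = 1, the value at τ is zero, the value at γ is free, and H¹ = ℤ₂/(ψ(γ) - 1); for
ψ(a) = aⁿ the identity |5ⁿ - 1| = |n|/4 computes this quotient. If ψ(τ) = -1, the value at τ is free
and counts modulo 2, so H¹ = ℤ/2.

Higher degrees use two extensions of coefficients. The difference operator along γ gives 0 → C({±1})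
→ C(G) → C(G) → 0, continuously split by Mahler's theorem; C(G) is acyclic, so C({±1}) has no
cohomology in degrees ≥ 2 (`subsingleton_signRep`). With χ the sign character, 0 → ψ → C({±1}) → ψχ
→ 0 then gives Hˢ(ψχ) ≅ Hˢ⁺¹(ψ) for s ≥ 2 (`charH_shift`) and presents H²(ψ) as a quotient of
H¹(ψχ), which a parity computation identifies with ℤ/2 (`charH_two`). -/

set_option linter.unusedSectionVars false

noncomputable section

/-! ### Continuous cohomology by explicit cocycles, and its functoriality. -/

section GeneralCohomology

universe u

variable {k : Type u} [CommRing k]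
  {G M : Type u} [Group G] [TopologicalSpace G] [IsTopologicalGroup G]
  [AddCommGroup M] [Module k M] [TopologicalSpace M] [IsTopologicalAddGroup M]
  [ContinuousConstSMul k M]
  {G' M' : Type u} [Group G'] [TopologicalSpace G'] [IsTopologicalGroup G']
  [AddCommGroup M'] [Module k M'] [TopologicalSpace M'] [IsTopologicalAddGroup M']
  [ContinuousConstSMul k M']
  {ρ : Representation k G M} (hρ : Continuous fun p : G × M => ρ p.1 p.2)
  {ρ' : Representation k G' M'} (hρ' : Continuous fun p : G' × M' => ρ' p.1 p.2)

theorem contD_apply (n : ℕ) (f : C(Fin n → G, M)) (g : Fin (n + 1) → G) :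
    contD ρ hρ n f g = ρ (g 0) (f fun i => g i.succ) +
      ∑ j : Fin (n + 1), (-1 : k) ^ ((j : ℕ) + 1) • f (Fin.contractNth j (· * ·) g) := rfl

/-- The map on continuous cochains induced by a continuous homomorphism `G' → G` and a
continuous linear map `M → M'`. -/
def cochainsMapAt (e : G' →ₜ* G) (φ : M →L[k] M') (n : ℕ) :
    C(Fin n → G, M) →ₗ[k] C(Fin n → G', M') where
  toFun f := ⟨fun g => φ (f fun i => e (g i)), by fun_prop⟩
  map_add' f f' := by ext g; simp
  map_smul' r f := by ext g; simp

@[simp]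
theorem cochainsMapAt_apply (e : G' →ₜ* G) (φ : M →L[k] M') (n : ℕ) (f : C(Fin n → G, M))
    (g : Fin n → G') : cochainsMapAt e φ n f g = φ (f fun i => e (g i)) := rfl

theorem contD_cochainsMapAt (e : G' →ₜ* G) (φ : M →L[k] M')
    (h : ∀ g x, φ (ρ (e g) x) = ρ' g (φ x)) (n : ℕ) (f : C(Fin n → G, M)) :
    contD ρ' hρ' n (cochainsMapAt e φ n f) = cochainsMapAt e φ (n + 1) (contD ρ hρ n f) := by
  ext g
  simp only [contD_apply, cochainsMapAt_apply, map_add, map_sum, map_smul, h]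
  congr 1
  refine Finset.sum_congr rfl fun j _ => ?_
  congr 3
  have := Fin.comp_contractNth (opα := (· * · : G' → G' → G')) (opβ := (· * · : G → G → G))
    (f := e) (fun a b => map_mul e a b) j g
  exact this

theorem contCochains_d (n : ℕ) :
    (contCochains ρ hρ).d n (n + 1) = ModuleCat.ofHom (contD ρ hρ n) :=
  CochainComplex.of_d (fun n => ModuleCat.of k C(Fin n → G, M))
    (fun n => ModuleCat.ofHom (contD ρ hρ n)) n

/-- The chain map of continuous cochain complexes induced by compatible maps. -/
def contMap (e : G' →ₜ* G) (φ : M →L[k] M') (h : ∀ g x, φ (ρ (e g) x) = ρ' g (φ x)) :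
    contCochains ρ hρ ⟶ contCochains ρ' hρ' :=
  CochainComplex.ofHom (fun n => ModuleCat.ofHom (cochainsMapAt e φ n)) fun n => by
    rw [contCochains_d, contCochains_d]
    ext f
    exact contD_cochainsMapAt hρ hρ' e φ h n f

/-- The cohomology class of a continuous cocycle. -/
def contClass (n : ℕ) : LinearMap.ker (contD ρ hρ n) →ₗ[k] contCohomology ρ hρ n :=
  ((contCochains ρ hρ).liftCycles
    (ModuleCat.ofHom (LinearMap.ker (contD ρ hρ n)).subtype) (n + 1) (by simp) (by
      rw [contCochains_d]
      ext f
      exact f.2) ≫ (contCochains ρ hρ).homologyπ n).hom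

theorem exists_liftCycles_eq (n : ℕ) (z : (contCochains ρ hρ).cycles n) :
    ∃ c : LinearMap.ker (contD ρ hρ n), ((contCochains ρ hρ).liftCycles
      (ModuleCat.ofHom (LinearMap.ker (contD ρ hρ n)).subtype) (n + 1) (by simp) (by
        rw [contCochains_d]
        ext f
        exact f.2)).hom c = z := by
  have hz : contD ρ hρ n (((contCochains ρ hρ).iCycles n).hom z) = 0 := by
    have h := congrArg (fun φ => φ.hom z) ((contCochains ρ hρ).iCycles_d n (n + 1))
    rw [contCochains_d] at h
    exact h
  refine ⟨⟨((contCochains ρ hρ).iCycles n).hom z, hz⟩, ?_⟩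
  apply (ModuleCat.mono_iff_injective ((contCochains ρ hρ).iCycles n)).1 inferInstance
  exact congrArg (fun φ => φ.hom (⟨((contCochains ρ hρ).iCycles n).hom z, hz⟩ :
    LinearMap.ker (contD ρ hρ n))) ((contCochains ρ hρ).liftCycles_i
      (ModuleCat.ofHom (LinearMap.ker (contD ρ hρ n)).subtype) (n + 1) (by simp) (by
        rw [contCochains_d]
        ext f
        exact f.2))

theorem contClass_surjective (n : ℕ) : Function.Surjective (contClass hρ n) := by
  intro x
  obtain ⟨z, rfl⟩ := (ModuleCat.epi_iff_surjective ((contCochains ρ hρ).homologyπ n)).1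
    inferInstance x
  obtain ⟨c, rfl⟩ := exists_liftCycles_eq hρ n z
  exact ⟨c, rfl⟩

/-- `homologyπ` is a cokernel of `toCycles`, which for modules is exactness on elements. -/
theorem exists_toCycles_eq {n m : ℕ} (hm : (ComplexShape.up ℕ).prev n = m)
    (z : (contCochains ρ hρ).cycles n) (hz : ((contCochains ρ hρ).homologyπ n).hom z = 0) :
    ∃ b, ((contCochains ρ hρ).toCycles m n).hom b = z := by
  have h := ShortComplex.exact_of_g_is_cokernel (ShortComplex.mk _ _
    ((contCochains ρ hρ).toCycles_comp_homologyπ m n))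
    ((contCochains ρ hρ).homologyIsCokernel m n hm)
  rw [ShortComplex.moduleCat_exact_iff] at h
  exact h z hz

theorem contClass_iCycles (n : ℕ) (c : LinearMap.ker (contD ρ hρ n)) :
    ∃ z : (contCochains ρ hρ).cycles n, ((contCochains ρ hρ).iCycles n).hom z = c.1 ∧
      contClass hρ n c = ((contCochains ρ hρ).homologyπ n).hom z :=
  ⟨_, congrArg (fun φ => φ.hom c) ((contCochains ρ hρ).liftCycles_i
      (ModuleCat.ofHom (LinearMap.ker (contD ρ hρ n)).subtype) (n + 1) (by simp) (by
        rw [contCochains_d]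
        ext f
        exact f.2)), rfl⟩

theorem iCycles_injective (n : ℕ) :
    Function.Injective ((contCochains ρ hρ).iCycles n).hom :=
  (ModuleCat.mono_iff_injective ((contCochains ρ hρ).iCycles n)).1 inferInstance

theorem contClass_zero_injective : Function.Injective (contClass hρ 0) := by
  rw [injective_iff_map_eq_zero]
  intro c hc
  obtain ⟨z, hz, hcz⟩ := contClass_iCycles hρ 0 c
  rw [hcz] at hc
  -- By convention the predecessor of 0 in `ComplexShape.up ℕ` is 0 itself, and the differential
  -- from degree 0 to degree 0 is zero.
  obtain ⟨b, rfl⟩ := exists_toCycles_eq hρ (m := 0) (by simp) z hc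
  have h0 : (contCochains ρ hρ).toCycles 0 0 = 0 := by
    rw [← cancel_mono ((contCochains ρ hρ).iCycles 0), HomologicalComplex.toCycles_i]
    simp
  rw [h0] at hz
  ext1
  rw [← hz]
  exact map_zero ((contCochains ρ hρ).iCycles 0).hom

/-- With `contClass_surjective`, this replaces abstract homology by cocycles modulo coboundaries. -/
theorem contClass_succ_eq_zero_iff (n : ℕ) (c : LinearMap.ker (contD ρ hρ (n + 1))) :
    contClass hρ (n + 1) c = 0 ↔ ∃ b, contD ρ hρ n b = c.1 := by
  obtain ⟨z, hz, hcz⟩ := contClass_iCycles hρ (n + 1) c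
  have hi : (contCochains ρ hρ).toCycles n (n + 1) ≫ (contCochains ρ hρ).iCycles (n + 1) =
      ModuleCat.ofHom (contD ρ hρ n) := by
    rw [HomologicalComplex.toCycles_i, contCochains_d]
  rw [hcz]
  constructor
  · intro h
    obtain ⟨b, rfl⟩ := exists_toCycles_eq hρ (m := n) (by simp) z h
    exact ⟨b, (congrArg (fun φ => φ.hom b) hi).symm.trans hz⟩
  · rintro ⟨b, hb⟩
    have : z = ((contCochains ρ hρ).toCycles n (n + 1)).hom b := by
      apply iCycles_injective hρ
      rw [hz, ← hb]
      exact (congrArg (fun φ => φ.hom b) hi).symm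
    rw [this]
    exact congrArg (fun φ => φ.hom b)
      ((contCochains ρ hρ).toCycles_comp_homologyπ n (n + 1))

theorem homologyMap_contClass (e : G' →ₜ* G) (φ : M →L[k] M')
    (h : ∀ g x, φ (ρ (e g) x) = ρ' g (φ x)) (n : ℕ) (c : LinearMap.ker (contD ρ hρ n)) :
    (HomologicalComplex.homologyMap (contMap hρ hρ' e φ h) n).hom (contClass hρ n c) =
      contClass hρ' n ⟨cochainsMapAt e φ n c.1, by
        rw [LinearMap.mem_ker, contD_cochainsMapAt hρ hρ' e φ h, LinearMap.mem_ker.1 c.2,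
          map_zero]⟩ := by
  obtain ⟨z, hz, hcz⟩ := contClass_iCycles hρ n c
  obtain ⟨z', hz', hcz'⟩ := contClass_iCycles hρ' n ⟨cochainsMapAt e φ n c.1, by
        rw [LinearMap.mem_ker, contD_cochainsMapAt hρ hρ' e φ h, LinearMap.mem_ker.1 c.2,
          map_zero]⟩
  rw [hcz, hcz']
  have h1 := congrArg (fun φ => φ.hom z)
    (HomologicalComplex.homologyπ_naturality (contMap hρ hρ' e φ h) n)
  refine h1.trans ?_
  have : z' = (HomologicalComplex.cyclesMap (contMap hρ hρ' e φ h) n).hom z := by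
    apply iCycles_injective hρ'
    rw [hz']
    have h2 := congrArg (fun φ => φ.hom z)
      (HomologicalComplex.cyclesMap_i (contMap hρ hρ' e φ h) n)
    refine Eq.trans ?_ h2.symm
    change _ = cochainsMapAt e φ n (((contCochains ρ hρ).iCycles n).hom z)
    rw [hz]
  rw [this]
  rfl

/-- Compatible isomorphisms of topological groups and modules induce isomorphisms on continuous
cohomology. -/
def contCohomologyEquiv (e : G' ≃ₜ* G) (φ : M ≃L[k] M')
    (h : ∀ g x, φ (ρ (e g) x) = ρ' g (φ x)) (n : ℕ) :
    contCohomology ρ hρ n ≃ₗ[k] contCohomology ρ' hρ' n :=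
  (HomologicalComplex.homologyMapIso (C := ModuleCat k)
    { hom := contMap hρ hρ' (e : G' →ₜ* G) (φ : M →L[k] M') h
      inv := contMap hρ' hρ (e.symm : G →ₜ* G') (φ.symm : M' →L[k] M) fun g x => by
        apply φ.injective
        have := h (e.symm g) (φ.symm x)
        simpa using this.symm
      hom_inv_id := by
        refine HomologicalComplex.hom_ext _ _ fun n => ModuleCat.hom_ext (LinearMap.ext ?_)
        intro (f : C(Fin n → G, M))
        refine ContinuousMap.ext fun g => ?_
        change φ.symm (φ (f fun i => e (e.symm (g i)))) = f g
        simp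
      inv_hom_id := by
        refine HomologicalComplex.hom_ext _ _ fun n => ModuleCat.hom_ext (LinearMap.ext ?_)
        intro (f : C(Fin n → G', M'))
        refine ContinuousMap.ext fun g => ?_
        change φ (φ.symm (f fun i => e.symm (e (g i)))) = f g
        simp } n).toLinearEquiv

theorem subsingleton_contCohomology_of_subsingleton [Subsingleton M] (n : ℕ) :
    Subsingleton (contCohomology ρ hρ n) := by
  have : Subsingleton (LinearMap.ker (contD ρ hρ n)) :=
    ⟨fun a b => Subtype.ext (ContinuousMap.ext fun x => Subsingleton.elim _ _)⟩
  exact (contClass_surjective hρ n).subsingleton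

/-! ### Degree zero and one -/

theorem contD_zero_apply (f : C(Fin 0 → G, M)) (g : Fin 1 → G) :
    contD ρ hρ 0 f g = ρ (g 0) (f default) - f default := by
  rw [contD_apply]
  have h : ∀ x : Fin 0 → G, x = default := fun x => Subsingleton.elim _ _
  simp [h, sub_eq_add_neg]

theorem contD_one_apply (f : C(Fin 1 → G, M)) (g : Fin 2 → G) :
    contD ρ hρ 1 f g = ρ (g 0) (f fun _ => g 1) - f (fun _ => g 0 * g 1) + f fun _ => g 0 := by
  rw [contD_apply, Fin.sum_univ_two, sub_eq_add_neg, add_assoc]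
  congr 2
  · congr 1
    ext i
    fin_cases i
    rfl
  · simp only [Fin.val_zero, zero_add, pow_one, neg_smul, one_smul]
    congr 2
    ext i
    fin_cases i
    rfl
  · simp only [Fin.val_one, one_add_one_eq_two, even_two, Even.neg_pow, one_pow, one_smul]
    congr 1
    ext i
    fin_cases i
    rfl

/-- Continuous crossed homomorphisms. -/
def crossedHoms (ρ : Representation k G M) : Submodule k C(G, M) where
  carrier := {c | ∀ g h, c (g * h) = c g + ρ g (c h)}
  zero_mem' := fun g h => by simp
  add_mem' := fun {a b} ha hb g h => by simp [ha g h, hb g h]; abel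
  smul_mem' := fun r a ha g h => by simp [ha g h]

theorem apply_one_of_mem_crossedHoms {c : C(G, M)} (hc : c ∈ crossedHoms ρ) : c 1 = 0 := by
  simpa using hc 1 1

/-- The one-cocycle attached to a crossed homomorphism. -/
def crossedHomsToCocycles : crossedHoms ρ →ₗ[k] LinearMap.ker (contD ρ hρ 1) where
  toFun c := ⟨⟨fun g => c.1 (g 0), by fun_prop⟩, by
    rw [LinearMap.mem_ker]
    ext g
    rw [contD_one_apply]
    have := c.2 (g 0) (g 1)
    simp [this]⟩
  map_add' a b := rfl
  map_smul' r a := rfl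

/-- The class in `H¹` of a continuous crossed homomorphism. -/
def crossedClass : crossedHoms ρ →ₗ[k] contCohomology ρ hρ 1 :=
  contClass hρ 1 ∘ₗ crossedHomsToCocycles hρ

theorem crossedClass_surjective : Function.Surjective (crossedClass hρ) := by
  refine (contClass_surjective hρ 1).comp ?_
  rintro ⟨f, hf⟩
  refine ⟨⟨⟨fun g => f fun _ => g, by fun_prop⟩, fun g h => ?_⟩, ?_⟩
  · have := congrArg (fun φ => φ ![g, h]) (LinearMap.mem_ker.1 hf)
    simp only [contD_one_apply] at this
    simp only [ContinuousMap.coe_mk]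
    have h2 : ρ g (f fun _ => h) - f (fun _ => g * h) + f (fun _ => g) = 0 := this
    rw [← sub_eq_zero, ← neg_eq_zero, ← h2]
    abel
  · ext g
    change f (fun _ => g 0) = f g
    congr 1
    ext i
    rw [Subsingleton.elim i 0]

theorem crossedClass_eq_zero_iff (c : crossedHoms ρ) :
    crossedClass hρ c = 0 ↔ ∃ x : M, ∀ g, c.1 g = ρ g x - x := by
  refine (contClass_succ_eq_zero_iff hρ 0 _).trans ?_
  constructor
  · rintro ⟨b, hb⟩
    refine ⟨b default, fun g => ?_⟩
    have := congrArg (fun φ => φ fun _ => g) hb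
    simp only [contD_zero_apply] at this
    exact this.symm
  · rintro ⟨x, hx⟩
    refine ⟨.const _ x, ?_⟩
    ext g
    rw [contD_zero_apply]
    exact (hx (g 0)).symm

theorem crossedClass_eq_iff (c c' : crossedHoms ρ) :
    crossedClass hρ c = crossedClass hρ c' ↔ ∃ x : M, ∀ g, c.1 g - c'.1 g = ρ g x - x := by
  rw [← sub_eq_zero, ← map_sub]
  exact crossedClass_eq_zero_iff hρ (c - c')

theorem homologyMap_crossedClass {ρ' : Representation k G M'}
    (hρ' : Continuous fun p : G × M' => ρ' p.1 p.2) (φ : M →L[k] M')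
    (h : ∀ g x, φ (ρ g x) = ρ' g (φ x)) (c : crossedHoms ρ) :
    (HomologicalComplex.homologyMap (contMap hρ hρ' (.id G) φ h) 1).hom (crossedClass hρ c) =
      crossedClass hρ' ⟨(φ : C(M, M')).comp c.1, fun a b => by simp [c.2 a b, h]⟩ :=
  homologyMap_contClass hρ hρ' (.id G) φ h 1 _

/-- `H⁰` is the module of invariants. -/
def contCohomologyZeroEquiv : contCohomology ρ hρ 0 ≃ₗ[k] ρ.invariants :=
  (LinearEquiv.ofBijective (contClass hρ 0)
    ⟨contClass_zero_injective hρ, contClass_surjective hρ 0⟩).symm ≪≫ₗ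
  { toFun := fun f => ⟨f.1 default, fun g => by
      have := congrArg (fun φ => φ fun _ => g) (LinearMap.mem_ker.1 f.2)
      simp only [contD_zero_apply] at this
      exact sub_eq_zero.1 this⟩
    map_add' := fun _ _ => rfl
    map_smul' := fun _ _ => rfl
    invFun := fun x => ⟨.const _ x.1, by
      rw [LinearMap.mem_ker]
      ext g
      rw [contD_zero_apply]
      simp [x.2 (g 0)]⟩
    left_inv := fun f => by
      ext g
      change f.1 default = f.1 g
      congr 1
      exact Subsingleton.elim _ _
    right_inv := fun x => rfl }

end GeneralCohomology

/-! ### The long exact sequence of a continuously split extension. -/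

section LongExactSequence

universe u

variable {k : Type u} [CommRing k] {G : Type u} [Group G] [TopologicalSpace G]
  [IsTopologicalGroup G]
  {A B C : Type u}
  [AddCommGroup A] [Module k A] [TopologicalSpace A] [IsTopologicalAddGroup A]
  [ContinuousConstSMul k A]
  [AddCommGroup B] [Module k B] [TopologicalSpace B] [IsTopologicalAddGroup B]
  [ContinuousConstSMul k B]
  [AddCommGroup C] [Module k C] [TopologicalSpace C] [IsTopologicalAddGroup C]
  [ContinuousConstSMul k C]
  {ρA : Representation k G A} (hA : Continuous fun p : G × A => ρA p.1 p.2)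
  {ρB : Representation k G B} (hB : Continuous fun p : G × B => ρB p.1 p.2)
  {ρC : Representation k G C} (hC : Continuous fun p : G × C => ρC p.1 p.2)

/-- A continuously split (as spaces) short exact sequence of coefficients gives a short exact
sequence of complexes of continuous cochains. -/
theorem exists_shortExact (i : A →L[k] B) (hi : ∀ g x, i (ρA g x) = ρB g (i x))
    (q : B →L[k] C) (hq : ∀ g x, q (ρB g x) = ρC g (q x))
    (hqi : ∀ a, q (i a) = 0) (r : C(B, A)) (hri : ∀ a, r (i a) = a)
    (hir : ∀ b, q b = 0 → i (r b) = b) (σ : C(C, B)) (hσ : ∀ c, q (σ c) = c) :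
    ∃ w : contMap hA hB (.id G) i hi ≫ contMap hB hC (.id G) q hq = 0,
      (ShortComplex.mk _ _ w).ShortExact := by
  refine ⟨?_, ?_⟩
  · refine HomologicalComplex.hom_ext _ _ fun n => ModuleCat.hom_ext (LinearMap.ext ?_)
    intro (f : C(Fin n → G, A))
    refine ContinuousMap.ext fun g => ?_
    exact hqi _
  -- Exactness is checked on cochains of a fixed degree, by composing with `r` and `σ`; these need
  -- only be continuous, not linear or equivariant.
  · refine HomologicalComplex.shortExact_of_degreewise_shortExact _ fun n => ?_
    refine ModuleCat.shortComplex_shortExact _ ?_ ?_ ?_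
    · intro (f : C(Fin n → G, B))
      constructor
      · intro h
        refine ⟨r.comp f, ContinuousMap.ext fun g => hir _ ?_⟩
        exact congrArg (fun φ : C(Fin n → G, C) => φ g) h
      · rintro ⟨f, rfl⟩
        refine ContinuousMap.ext fun g => ?_
        exact hqi _
    · intro (f : C(Fin n → G, A)) (f' : C(Fin n → G, A)) h
      refine ContinuousMap.ext fun g => ?_
      have : i (f g) = i (f' g) := congrArg (fun φ : C(Fin n → G, B) => φ g) h
      rw [← hri (f g), this, hri]
    · intro (f : C(Fin n → G, C))
      exact ⟨σ.comp f, ContinuousMap.ext fun g => hσ _⟩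

/-- The connecting homomorphism in continuous cohomology. -/
theorem exists_connecting (i : A →L[k] B) (hi : ∀ g x, i (ρA g x) = ρB g (i x))
    (q : B →L[k] C) (hq : ∀ g x, q (ρB g x) = ρC g (q x))
    (hqi : ∀ a, q (i a) = 0) (r : C(B, A)) (hri : ∀ a, r (i a) = a)
    (hir : ∀ b, q b = 0 → i (r b) = b) (σ : C(C, B)) (hσ : ∀ c, q (σ c) = c) (n : ℕ) :
    ∃ δ : contCohomology ρC hC n →ₗ[k] contCohomology ρA hA (n + 1),
      (∀ x, δ x = 0 ↔
        ∃ y, (HomologicalComplex.homologyMap (contMap hB hC (.id G) q hq) n).hom y = x) ∧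
      (Subsingleton (contCohomology ρB hB (n + 1)) → Function.Surjective δ) := by
  obtain ⟨w, hS⟩ := exists_shortExact hA hB hC i hi q hq hqi r hri hir σ hσ
  refine ⟨(hS.δ n (n + 1) rfl).hom, fun x => ?_, fun h x => ?_⟩
  · have h3 := (ShortComplex.moduleCat_exact_iff _).1 (hS.homology_exact₃ n (n + 1) rfl)
    refine ⟨fun hx => h3 x hx, ?_⟩
    rintro ⟨y, rfl⟩
    exact congrArg (fun φ => φ.hom y) (hS.comp_δ n (n + 1) rfl)
  · have h1 := (ShortComplex.moduleCat_exact_iff _).1 (hS.homology_exact₁ n (n + 1) rfl)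
    exact h1 x (h.elim _ _)

end LongExactSequence

/-! ### Acyclicity of coinduced coefficients. -/

section Coinduced

universe u

variable {k : Type u} [CommRing k]
  {G M : Type u} [Group G] [TopologicalSpace G] [IsTopologicalGroup G]
  [AddCommGroup M] [Module k M] [TopologicalSpace M] [IsTopologicalAddGroup M]
  [ContinuousConstSMul k M]
  {ρ : Representation k G M} (hρ : Continuous fun p : G × M => ρ p.1 p.2)

theorem continuous_rep_apply {ρ : Representation k G M}
    (hρ : Continuous fun p : G × M => ρ p.1 p.2) (g : G) : Continuous (ρ g) :=
  hρ.comp (Continuous.prodMk continuous_const continuous_id)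

variable {Q : Type u} [Group Q] [TopologicalSpace Q] [IsTopologicalGroup Q]

/-- The diagonal action `(h F)(q) = h (F (q π(h)))` on continuous functions on a group `Q` under
`G`. -/
def funRep (π : G →ₜ* Q) : Representation k G C(Q, M) where
  toFun h :=
    { toFun := fun F =>
        ⟨fun q => ρ h (F (q * π h)), (continuous_rep_apply hρ h).comp (by fun_prop)⟩
      map_add' := fun F F' => by ext g; simp
      map_smul' := fun r F => by ext g; simp }
  map_one' := by ext F g; simp
  map_mul' h h' := by ext F g; simp [mul_assoc]

@[simp]
theorem funRep_apply (π : G →ₜ* Q) (h : G) (F : C(Q, M)) (q : Q) :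
    funRep hρ π h F q = ρ h (F (q * π h)) := rfl

theorem continuous_funRep [LocallyCompactSpace Q] (π : G →ₜ* Q) :
    Continuous fun p : G × C(Q, M) => funRep hρ π p.1 p.2 := by
  refine ContinuousMap.continuous_of_continuous_uncurry _ ?_
  change Continuous fun p : (G × C(Q, M)) × Q => ρ p.1.1 (p.1.2 (p.2 * π p.1.1))
  exact hρ.comp (Continuous.prodMk (by fun_prop) (by fun_prop))

theorem funRep_id_apply (h : G) (F : C(G, M)) (q : G) :
    funRep hρ (.id G) h F q = ρ h (F (q * h)) := rfl

theorem contractNth_zero_cons {n : ℕ} (x : G) (g : Fin (n + 1) → G) :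
    Fin.contractNth 0 (· * ·) (Fin.cons x g : Fin (n + 2) → G) =
      Fin.cons (x * g 0) fun i => g i.succ := by
  ext i
  refine Fin.cases ?_ (fun i => ?_) i
  · simp [Fin.contractNth]
  · simp [Fin.contractNth]

theorem contractNth_succ_cons {n : ℕ} (j : Fin (n + 1)) (x : G) (g : Fin (n + 1) → G) :
    Fin.contractNth j.succ (· * ·) (Fin.cons x g : Fin (n + 2) → G) =
      Fin.cons x (Fin.contractNth j (· * ·) g) := by
  ext i
  refine Fin.cases ?_ (fun i => ?_) i
  · simp [Fin.contractNth]
  · simp [Fin.contractNth]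

/-- Continuous functions on the group are acyclic coefficients. -/
theorem subsingleton_contCohomology_funRep [LocallyCompactSpace G] (n : ℕ) :
    Subsingleton (contCohomology (funRep hρ (.id G)) (continuous_funRep hρ (.id G)) (n + 1)) := by
  refine subsingleton_of_forall_eq 0 fun y => ?_
  obtain ⟨⟨f, hf⟩, rfl⟩ := contClass_surjective (continuous_funRep hρ (.id G)) (n + 1) y
  rw [contClass_succ_eq_zero_iff]
  rw [LinearMap.mem_ker] at hf
  -- The contracting homotopy: prepend x to the arguments of f, evaluate at 1, and untwist by x⁻¹.
  let s : C(Fin n → G, C(G, M)) :=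
    ⟨fun g => ⟨fun x => ρ x⁻¹ (f (Fin.cons x g) 1),
      hρ.comp (Continuous.prodMk (by fun_prop) (by fun_prop))⟩, by
      refine ContinuousMap.continuous_of_continuous_uncurry _ ?_
      change Continuous fun p : (Fin n → G) × G =>
        ρ p.2⁻¹ (f (Fin.cons p.2 p.1) 1)
      exact hρ.comp (Continuous.prodMk (by fun_prop) (by fun_prop))⟩
  have hs : ∀ g x, s g x = ρ x⁻¹ (f (Fin.cons x g) 1) := fun _ _ => rfl
  refine ⟨s, ?_⟩
  ext g x
  -- The cocycle identity at (x, g), evaluated at 1 and untwisted by x⁻¹: its leading term is f g x,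
  -- the remaining terms are those of -(ds) g x.
  have h := congrArg (fun φ : C(Fin (n + 2) → G, C(G, M)) => ρ x⁻¹ (φ (Fin.cons x g) 1)) hf
  simp only [contD_apply, Fin.sum_univ_succ (n := n + 1), contractNth_zero_cons,
    contractNth_succ_cons, ContinuousMap.add_apply, ContinuousMap.smul_apply,
    ContinuousMap.sum_apply, funRep_id_apply, map_add, map_sum, map_smul] at h
  simp only [contD_apply, ContinuousMap.add_apply, ContinuousMap.smul_apply,
    ContinuousMap.sum_apply, funRep_id_apply, hs]
  have e1 : ρ x⁻¹ (ρ x (f g x)) = f g x := by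
    rw [← Module.End.mul_apply, ← map_mul]; simp
  have e2 : ∀ y : M, ρ (g 0) (ρ (x * g 0)⁻¹ y) = ρ x⁻¹ y := fun y => by
    rw [← Module.End.mul_apply, ← map_mul]; simp
  simp only [Fin.cons_zero, Fin.cons_succ, one_mul, e1, Fin.val_zero, zero_add, neg_smul,
    one_smul, Fin.val_succ, ContinuousMap.zero_apply, map_zero, pow_zero, pow_succ, mul_neg, mul_one,
    neg_neg] at h
  simp only [e2, pow_succ, mul_neg, mul_one, neg_smul, Finset.sum_neg_distrib]
  rw [← sub_eq_zero, ← neg_eq_zero, ← h]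
  abel

end Coinduced

/-! ### Discrete antiderivatives from Mahler expansions. -/

section Antidifference

open scoped ZeroAtInfty in
/-- Mahler's theorem provides a continuous right inverse of the difference operator on continuous
functions on the `p`-adic integers. -/
theorem exists_antidifference (p : ℕ) [Fact p.Prime] : ∃ S : C(C(ℤ_[p], ℤ_[p]), C(ℤ_[p], ℤ_[p])),
    ∀ f x, S f (x + 1) - S f x = f x := by
  -- Differencing deletes the zeroth Mahler coefficient and shifts the rest down, so shifting up
  -- with a leading 0 is a right inverse; it is continuous because it does not increase norms.
  let sh : C₀(ℕ, ℤ_[p]) →+ C₀(ℕ, ℤ_[p]) :=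
    { toFun := fun a => ⟨⟨fun n => Nat.casesOn n 0 fun m => a m, continuous_of_discreteTopology⟩, by
        rw [cocompact_eq_atTop, ← Filter.tendsto_add_atTop_iff_nat 1]
        have := a.zero_at_infty'
        rw [cocompact_eq_atTop] at this
        exact this⟩
      map_zero' := by ext n; cases n <;> rfl
      map_add' := fun a b => by ext n; cases n <;> simp }
  have hsh : ∀ a n, sh a (n + 1) = a n := fun _ _ => rfl
  have hb : ∀ a, ‖sh a‖ ≤ 1 * ‖a‖ := by
    intro a
    rw [one_mul, ← ZeroAtInftyContinuousMap.norm_toBCF_eq_norm,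
      ← ZeroAtInftyContinuousMap.norm_toBCF_eq_norm]
    refine (BoundedContinuousFunction.norm_le (norm_nonneg _)).2 fun n => ?_
    cases n with
    | zero =>
      change ‖(0 : ℤ_[p])‖ ≤ _
      rw [norm_zero]
      exact norm_nonneg _
    | succ n => exact BoundedContinuousFunction.norm_coe_le_norm a.toBCF n
  have hc : Continuous sh := AddMonoidHomClass.continuous_of_bound sh 1 hb
  refine ⟨⟨fun f => (PadicInt.mahlerEquiv (p := p) ℤ_[p]).symm
    (sh (PadicInt.mahlerEquiv (p := p) ℤ_[p] f)),
    by fun_prop⟩, fun f x => ?_⟩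
  set F : C(ℤ_[p], ℤ_[p]) := (PadicInt.mahlerEquiv (p := p) ℤ_[p]).symm
    (sh (PadicInt.mahlerEquiv (p := p) ℤ_[p] f)) with hF
  have hmF : PadicInt.mahlerEquiv (p := p) ℤ_[p] F = sh (PadicInt.mahlerEquiv (p := p) ℤ_[p] f) := by
    simp [hF]
  let D : C(ℤ_[p], ℤ_[p]) := ⟨fun x => F (x + 1) - F x, by fun_prop⟩
  have hD : D = f := by
    apply (PadicInt.mahlerEquiv (p := p) ℤ_[p]).injective
    refine ZeroAtInftyContinuousMap.ext fun n => ?_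
    rw [← hsh (PadicInt.mahlerEquiv (p := p) ℤ_[p] f), ← hmF]
    change (fwdDiff 1)^[n] D 0 = (fwdDiff 1)^[n + 1] F 0
    rw [Function.iterate_succ_apply]
    rfl
  exact congrArg (fun φ : C(ℤ_[p], ℤ_[p]) => φ x) hD

end Antidifference

/-! ### The group {±1} × ℤ₂ and the two coefficient extensions. -/

section SignedPadic

/-- The group `{±1} × ℤ₂`. -/
abbrev SignedPadic : Type := ℤˣ × Multiplicative ℤ_[2]

namespace SignedPadic

instance : CompactSpace (Multiplicative ℤ_[2]) := inferInstanceAs (CompactSpace ℤ_[2])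

instance : LocallyCompactSpace (Multiplicative ℤ_[2]) :=
  inferInstanceAs (LocallyCompactSpace ℤ_[2])


/-- The projection to the sign. -/
def sign : SignedPadic →ₜ* ℤˣ := ContinuousMonoidHom.fst _ _

/-- The element `-1` of the first factor. -/
def τ : SignedPadic := (-1, 1)

/-- The topological generator of the second factor. -/
def γ : SignedPadic := (1, Multiplicative.ofAdd 1)

/-- Inclusion of the second factor. -/
def ofPadic (x : ℤ_[2]) : SignedPadic := (1, Multiplicative.ofAdd x)

@[fun_prop]
theorem continuous_ofPadic : Continuous ofPadic :=
  Continuous.prodMk continuous_const continuous_ofAdd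

theorem ofPadic_add (x y : ℤ_[2]) : ofPadic (x + y) = ofPadic x * ofPadic y := by
  simp [ofPadic]

theorem ofPadic_one : ofPadic 1 = γ := rfl

theorem ofPadic_zero : ofPadic 0 = 1 := rfl

theorem τ_mul_τ : τ * τ = 1 := by simp [τ]

theorem eq_ofPadic_or (g : SignedPadic) : ∃ x, g = ofPadic x ∨ g = τ * ofPadic x := by
  obtain ⟨e, x⟩ := g
  refine ⟨x.toAdd, ?_⟩
  rcases Int.units_eq_one_or e with rfl | rfl
  · left; rfl
  · right; simp [τ, ofPadic]

/-- Two continuous functions on `ℤ₂` with the same recursion agree. -/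
theorem eq_of_step {X : Type*} [TopologicalSpace X] [T2Space X] {f f' : ℤ_[2] → X}
    (hf : Continuous f) (hf' : Continuous f') (h0 : f 0 = f' 0)
    (hs : ∀ x, f x = f' x → f (x + 1) = f' (x + 1)) (x : ℤ_[2]) : f x = f' x := by
  refine congrFun (PadicInt.denseRange_natCast.equalizer hf hf' (funext fun n => ?_)) x
  induction n with
  | zero => simpa using h0
  | succ n ih => simpa using hs _ ih

/-- The one-dimensional representation attached to a character. -/
def charRep (ψ : SignedPadic →ₜ* ℤ_[2]ˣ) : Representation ℤ_[2] SignedPadic ℤ_[2] where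
  toFun g := LinearMap.mulLeft ℤ_[2] (ψ g : ℤ_[2])
  map_one' := by ext; simp
  map_mul' g h := by ext; simp

@[simp]
theorem charRep_apply (ψ : SignedPadic →ₜ* ℤ_[2]ˣ) (g : SignedPadic) (x : ℤ_[2]) :
    charRep ψ g x = ψ g * x := rfl

theorem continuous_charRep (ψ : SignedPadic →ₜ* ℤ_[2]ˣ) :
    Continuous fun p : SignedPadic × ℤ_[2] => charRep ψ p.1 p.2 := by
  change Continuous fun p : SignedPadic × ℤ_[2] => (ψ p.1 : ℤ_[2]) * p.2
  exact (Units.continuous_val.comp ((map_continuous ψ).comp continuous_fst)).mul continuous_snd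

/-- Cohomology with coefficients in a character. -/
abbrev charH (ψ : SignedPadic →ₜ* ℤ_[2]ˣ) (n : ℕ) : ModuleCat ℤ_[2] :=
  contCohomology (charRep ψ) (continuous_charRep ψ) n

/-- The sign character with values in `ℤ₂ˣ`. -/
def χ : SignedPadic →ₜ* ℤ_[2]ˣ where
  toMonoidHom := (Units.map (Int.castRingHom ℤ_[2]).toMonoidHom).comp (MonoidHom.fst _ _)
  continuous_toFun := (continuous_of_discreteTopology
    (f := Units.map (Int.castRingHom ℤ_[2]).toMonoidHom)).comp continuous_fst

theorem χ_apply (g : SignedPadic) : (χ g : ℤ_[2]) = ((g.1 : ℤ) : ℤ_[2]) := rfl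

section Antidiff

/-- The difference operator along the generator of the second factor. -/
def diffOp : C(SignedPadic, ℤ_[2]) →L[ℤ_[2]] C(SignedPadic, ℤ_[2]) where
  toFun F := ⟨fun g => F (g * γ) - F g, by fun_prop⟩
  map_add' F F' := by ext g; simp; ring
  map_smul' r F := by ext g; simp; ring
  cont := by
    refine ContinuousMap.continuous_of_continuous_uncurry _ ?_
    change Continuous fun p : C(SignedPadic, ℤ_[2]) × SignedPadic => p.1 (p.2 * γ) - p.1 p.2
    fun_prop

theorem diffOp_apply (F : C(SignedPadic, ℤ_[2])) (g : SignedPadic) :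
    diffOp F g = F (g * γ) - F g := rfl

/-- The antidifference is applied on each component {e} × ℤ₂. Joint continuity in F and g is what
yields a continuous map into the compact-open topology. -/
theorem exists_diffOp_section : ∃ σ : C(C(SignedPadic, ℤ_[2]), C(SignedPadic, ℤ_[2])),
    ∀ F, diffOp (σ F) = F := by
  obtain ⟨S, hS⟩ := exists_antidifference 2
  let res : C(SignedPadic, ℤ_[2]) → ℤˣ → C(ℤ_[2], ℤ_[2]) := fun F e =>
    ⟨fun x => F (e, Multiplicative.ofAdd x),
      F.continuous.comp (Continuous.prodMk continuous_const continuous_ofAdd)⟩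
  have hres : Continuous fun p : C(SignedPadic, ℤ_[2]) × SignedPadic => res p.1 p.2.1 := by
    refine ContinuousMap.continuous_of_continuous_uncurry _ ?_
    change Continuous fun p : (C(SignedPadic, ℤ_[2]) × SignedPadic) × ℤ_[2] =>
      p.1.1 (p.1.2.1, Multiplicative.ofAdd p.2)
    exact Continuous.eval (by fun_prop)
      (Continuous.prodMk (by fun_prop) (continuous_ofAdd.comp continuous_snd))
  have hF : Continuous fun p : C(SignedPadic, ℤ_[2]) × SignedPadic =>
      S (res p.1 p.2.1) p.2.2.toAdd :=
    Continuous.eval (S.continuous.comp hres)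
      (continuous_toAdd.comp (continuous_snd.comp continuous_snd))
  refine ⟨⟨fun F => ⟨fun g => S (res F g.1) g.2.toAdd,
    hF.comp (Continuous.prodMk continuous_const continuous_id)⟩,
    ContinuousMap.continuous_of_continuous_uncurry _ hF⟩, fun F => ?_⟩
  ext g
  rw [diffOp_apply]
  have := hS (res F g.1) g.2.toAdd
  simpa [γ, res] using this

variable (ψ : SignedPadic →ₜ* ℤ_[2]ˣ)

/-- The representation on functions on the sign group. -/
abbrev signRep : Representation ℤ_[2] SignedPadic C(ℤˣ, ℤ_[2]) :=
  funRep (continuous_charRep ψ) sign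

theorem continuous_signRep :
    Continuous fun p : SignedPadic × C(ℤˣ, ℤ_[2]) => signRep ψ p.1 p.2 :=
  continuous_funRep (continuous_charRep ψ) sign

/-- The kernel of the difference operator along γ on C(G) is C({±1}). Since C(G) has no
positive-degree cohomology, the connecting map from degree n + 1 is onto from zero. -/
theorem subsingleton_signRep (n : ℕ) :
    Subsingleton (contCohomology (signRep ψ) (continuous_signRep ψ) (n + 2)) := by
  obtain ⟨σ, hσ⟩ := exists_diffOp_section
  let i : C(ℤˣ, ℤ_[2]) →L[ℤ_[2]] C(SignedPadic, ℤ_[2]) :=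
    { toFun := fun F => F.comp ⟨Prod.fst, continuous_fst⟩
      map_add' := fun _ _ => rfl
      map_smul' := fun _ _ => rfl
      cont := ContinuousMap.continuous_precomp _ }
  let r : C(C(SignedPadic, ℤ_[2]), C(ℤˣ, ℤ_[2])) :=
    ⟨fun F => F.comp ⟨fun e => (e, 1), by fun_prop⟩, ContinuousMap.continuous_precomp _⟩
  obtain ⟨δ, -, hδ⟩ := exists_connecting (continuous_signRep ψ)
    (continuous_funRep (continuous_charRep ψ) (.id _))
    (continuous_funRep (continuous_charRep ψ) (.id _)) i (fun g F => rfl) diffOp (fun g F => by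
      ext x
      rw [diffOp_apply, funRep_apply, funRep_apply, funRep_apply, diffOp_apply, charRep_apply,
        charRep_apply, charRep_apply, mul_sub, mul_right_comm]) (fun F => by
      ext x
      rw [diffOp_apply]
      change F (x.1 * 1) - F x.1 = 0
      rw [mul_one, sub_self]) r (fun F => rfl) (fun F hF => by
      ext ⟨e, x⟩
      change F (e, 1) = F (e, Multiplicative.ofAdd x.toAdd)
      -- A function invariant under γ is constant on {e} × ℤ₂, since ℕ is dense in ℤ₂.
      refine eq_of_step (f := fun _ => F (e, 1)) (f' := fun y => F (e, Multiplicative.ofAdd y))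
        continuous_const (F.continuous.comp (Continuous.prodMk continuous_const continuous_ofAdd))
        rfl (fun y hy => ?_) x.toAdd
      have := congrArg (fun φ : C(SignedPadic, ℤ_[2]) => φ (e, Multiplicative.ofAdd y)) hF
      simp only [diffOp_apply, γ] at this
      rw [hy]
      simpa using (sub_eq_zero.1 this).symm) σ hσ (n + 1)
  have h1 := subsingleton_contCohomology_funRep (continuous_charRep ψ) n
  have h2 := subsingleton_contCohomology_funRep (continuous_charRep ψ) (n + 1)
  exact (hδ h2).subsingleton

/-- The difference of the two values of a function on the sign group. -/
def signDiff : C(ℤˣ, ℤ_[2]) →L[ℤ_[2]] ℤ_[2] where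
  toFun F := F 1 - F (-1)
  map_add' F F' := by simp; ring
  map_smul' r F := by simp; ring
  cont := by fun_prop

theorem signDiff_apply (F : C(ℤˣ, ℤ_[2])) : signDiff F = F 1 - F (-1) := rfl

/-- An element of sign -1 swaps the two values and so negates their difference; this is the twist by
χ. -/
theorem signDiff_signRep (g : SignedPadic) (F : C(ℤˣ, ℤ_[2])) :
    signDiff (signRep ψ g F) = charRep (ψ * χ) g (signDiff F) := by
  obtain ⟨e, x⟩ := g
  rw [charRep_apply, signDiff_apply, signDiff_apply, funRep_apply, funRep_apply, charRep_apply,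
    charRep_apply, ContinuousMonoidHom.mul_apply, Units.val_mul, χ_apply]
  change _ * F (1 * e) - _ * F (-1 * e) = _
  rcases Int.units_eq_one_or e with rfl | rfl
  · simp; ring
  · simp; ring

/-- Connecting map of 0 → ψ → C({±1}) → ψχ → 0, where ψ sits inside as the constant functions. -/
theorem exists_signConnecting (n : ℕ) :
    ∃ δ : charH (ψ * χ) n →ₗ[ℤ_[2]] charH ψ (n + 1),
      (∀ x, δ x = 0 ↔ ∃ y, (HomologicalComplex.homologyMap (contMap (continuous_signRep ψ)
        (continuous_charRep (ψ * χ)) (.id _) signDiff (signDiff_signRep ψ)) n).hom y = x) ∧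
      (Subsingleton (contCohomology (signRep ψ) (continuous_signRep ψ) (n + 1)) →
        Function.Surjective δ) := by
  let i : ℤ_[2] →L[ℤ_[2]] C(ℤˣ, ℤ_[2]) :=
    { toFun := fun x => .const _ x
      map_add' := fun _ _ => rfl
      map_smul' := fun _ _ => rfl
      cont := ContinuousMap.continuous_const' }
  -- The indicator of 1 has difference 1, so x ↦ x • w is a section of `signDiff`.
  let w : C(ℤˣ, ℤ_[2]) := ⟨fun e => if e = 1 then 1 else 0, continuous_of_discreteTopology⟩
  refine exists_connecting (continuous_charRep ψ) (continuous_signRep ψ)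
    (continuous_charRep (ψ * χ)) i (fun g F => rfl) signDiff (signDiff_signRep ψ)
    (fun a => sub_self a) ⟨fun F => F 1, by fun_prop⟩ (fun a => rfl) (fun F hF => ?_)
    ⟨fun x => x • w, by fun_prop⟩ (fun x => ?_) n
  · ext e
    change F 1 = F e
    rcases Int.units_eq_one_or e with rfl | rfl
    · rfl
    · exact sub_eq_zero.1 hF
  · have : (-1 : ℤˣ) ≠ 1 := by decide
    simp [signDiff_apply, w, this]

theorem charH_shift (n : ℕ) : Nonempty (charH (ψ * χ) (n + 2) ≃ₗ[ℤ_[2]] charH ψ (n + 3)) := by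
  obtain ⟨δ, h0, hs⟩ := exists_signConnecting ψ (n + 2)
  have h1 := subsingleton_signRep ψ n
  refine ⟨LinearEquiv.ofBijective δ ⟨?_, hs (subsingleton_signRep ψ (n + 1))⟩⟩
  rw [injective_iff_map_eq_zero]
  intro x hx
  obtain ⟨y, rfl⟩ := (h0 x).1 hx
  have hy : y = 0 := h1.elim y 0
  rw [hy, map_zero]
  rfl

end Antidiff

end SignedPadic

end SignedPadic

/-! ### Reduction modulo 2. -/

section Parity

theorem PadicInt.toZMod_eq_zero_iff_exists {x : ℤ_[2]} :
    PadicInt.toZMod x = 0 ↔ ∃ y, x = 2 * y := by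
  rw [← RingHom.mem_ker, PadicInt.ker_toZMod, PadicInt.maximalIdeal_eq_span_p,
    Ideal.mem_span_singleton]
  rfl

theorem PadicInt.toZMod_unit (u : ℤ_[2]ˣ) : PadicInt.toZMod (u : ℤ_[2]) = 1 := by
  have h : IsUnit (PadicInt.toZMod (u : ℤ_[2])) := u.isUnit.map _
  generalize PadicInt.toZMod (u : ℤ_[2]) = z at h
  revert h
  fin_cases z
  · intro h
    exact absurd h not_isUnit_zero
  · intro _
    rfl

theorem PadicInt.toZMod_surjective (p : ℕ) [Fact p.Prime] :
    Function.Surjective (PadicInt.toZMod : ℤ_[p] →+* ZMod p) :=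
  fun z => ⟨z.val, by simp⟩

/-- Two surjections with the same kernel have isomorphic targets. -/
theorem nonempty_addEquiv_of_surjective {Z H A : Type*} [AddCommGroup Z] [AddCommGroup H]
    [AddCommGroup A] (f : Z →+ H) (hf : Function.Surjective f) (q : Z →+ A)
    (hq : Function.Surjective q) (h : ∀ z, f z = 0 ↔ q z = 0) : Nonempty (H ≃+ A) := by
  have hk : f.ker = q.ker := by
    ext z
    exact h z
  exact ⟨(QuotientAddGroup.quotientKerEquivOfSurjective f hf).symm.trans
    ((QuotientAddGroup.quotientAddEquivOfEq hk).trans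
      (QuotientAddGroup.quotientKerEquivOfSurjective q hq))⟩

end Parity

/-! ### Crossed homomorphisms and the cohomology of characters. -/

namespace SignedPadic

variable (ψ : SignedPadic →ₜ* ℤ_[2]ˣ)

theorem character_τ : ψ τ = 1 ∨ ψ τ = -1 := by
  have h : (ψ τ : ℤ_[2]) * ψ τ = 1 := by
    rw [← Units.val_mul, ← map_mul, τ_mul_τ, map_one, Units.val_one]
  rcases mul_self_eq_one_iff.1 h with h | h
  · exact Or.inl (Units.ext h)
  · exact Or.inr (Units.ext h)

theorem character_eq_of_τ (h : ψ τ = 1) (g : SignedPadic) : ψ g = ψ (ofPadic g.2.toAdd) := by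
  obtain ⟨x, rfl | rfl⟩ := eq_ofPadic_or g
  · rfl
  · rw [map_mul, h, one_mul]
    congr 2
    simp [τ, ofPadic]

variable {ψ}

theorem crossed_mul {c : C(SignedPadic, ℤ_[2])} (hc : c ∈ crossedHoms (charRep ψ))
    (g h : SignedPadic) : c (g * h) = c g + ψ g * c h := hc g h

theorem crossed_τ {c : C(SignedPadic, ℤ_[2])} (hc : c ∈ crossedHoms (charRep ψ)) :
    c τ + ψ τ * c τ = 0 := by
  rw [← crossed_mul hc, τ_mul_τ, apply_one_of_mem_crossedHoms hc]

theorem crossed_γ {c : C(SignedPadic, ℤ_[2])} (hc : c ∈ crossedHoms (charRep ψ)) :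
    c γ + ψ γ * c τ = c τ + ψ τ * c γ := by
  rw [← crossed_mul hc, ← crossed_mul hc, mul_comm]

/-- τ and γ generate G topologically, and the cocycle rule propagates values along products. -/
theorem crossed_ext {c c' : C(SignedPadic, ℤ_[2])} (hc : c ∈ crossedHoms (charRep ψ))
    (hc' : c' ∈ crossedHoms (charRep ψ)) (h1 : c τ = c' τ) (h2 : c γ = c' γ) : c = c' := by
  have h : ∀ x, c (ofPadic x) = c' (ofPadic x) := by
    refine eq_of_step (by fun_prop) (by fun_prop) ?_ fun x hx => ?_
    · rw [ofPadic_zero, apply_one_of_mem_crossedHoms hc, apply_one_of_mem_crossedHoms hc']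
    · rw [ofPadic_add, ofPadic_one, crossed_mul hc, crossed_mul hc', hx, h2]
  ext g
  obtain ⟨x, rfl | rfl⟩ := eq_ofPadic_or g
  · exact h x
  · rw [crossed_mul hc, crossed_mul hc', h1, h]

theorem crossed_τ_eq_zero (hε : ψ τ = 1) {c : C(SignedPadic, ℤ_[2])}
    (hc : c ∈ crossedHoms (charRep ψ)) : c τ = 0 := by
  have := crossed_τ hc
  rw [hε, Units.val_one, one_mul, ← two_mul] at this
  exact (mul_eq_zero.1 this).resolve_left two_ne_zero

theorem crossed_ext_of_τ_eq_one (hε : ψ τ = 1) {c c' : C(SignedPadic, ℤ_[2])}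
    (hc : c ∈ crossedHoms (charRep ψ)) (hc' : c' ∈ crossedHoms (charRep ψ)) (h : c γ = c' γ) :
    c = c' :=
  crossed_ext hc hc' (by rw [crossed_τ_eq_zero hε hc, crossed_τ_eq_zero hε hc']) h

/-- Commutation of τ and γ becomes 2c(γ) = (1 - ψ(γ))c(τ), so c(τ) determines c(γ). -/
theorem crossed_ext_of_τ_eq_neg_one (hε : ψ τ = -1) {c c' : C(SignedPadic, ℤ_[2])}
    (hc : c ∈ crossedHoms (charRep ψ)) (hc' : c' ∈ crossedHoms (charRep ψ)) (h : c τ = c' τ) :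
    c = c' := by
  refine crossed_ext hc hc' h ?_
  have h1 := crossed_γ hc
  have h2 := crossed_γ hc'
  rw [hε, Units.val_neg, Units.val_one] at h1 h2
  rw [h] at h1
  have : 2 * (c γ - c' γ) = 0 := by linear_combination h1 - h2
  exact sub_eq_zero.1 ((mul_eq_zero.1 this).resolve_left two_ne_zero)

theorem exists_crossed_of_τ_eq_one (hε : ψ τ = 1) (y : ℤ_[2]) :
    ∃ c ∈ crossedHoms (charRep ψ), c γ = y := by
  obtain ⟨S, hS⟩ := exists_antidifference 2
  let v : C(ℤ_[2], ℤ_[2]) := ⟨fun x => ψ (ofPadic x),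
    Units.continuous_val.comp ((map_continuous ψ).comp continuous_ofPadic)⟩
  have hv : ∀ x, v x = ψ (ofPadic x) := fun _ => rfl
  -- This interpolates the sums 1 + ψ(γ) + ⋯ + ψ(γ)ˣ⁻¹; multiplying by y gives the crossed
  -- homomorphism.
  let m : C(ℤ_[2], ℤ_[2]) := ⟨fun x => S v x - S v 0, by fun_prop⟩
  have h0 : m 0 = 0 := sub_self _
  have hm : ∀ x, m (x + 1) = m x + v x := fun x => by
    change S v (x + 1) - S v 0 = S v x - S v 0 + v x
    rw [← hS v x]
    ring
  have hadd : ∀ x z, m (x + z) = m x + v x * m z := fun x => by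
    refine eq_of_step (by fun_prop) (by fun_prop) (by simp [h0]) fun z hz => ?_
    rw [← add_assoc, hm, hz, hm, hv (x + z), ofPadic_add, map_mul, Units.val_mul, ← hv, ← hv]
    ring
  refine ⟨⟨fun g => y * m g.2.toAdd, ?_⟩, fun g h => ?_, ?_⟩
  · exact continuous_const.mul (m.continuous.comp (continuous_toAdd.comp continuous_snd))
  · have := hadd g.2.toAdd h.2.toAdd
    rw [charRep_apply, character_eq_of_τ ψ hε g, ← hv]
    simp only [ContinuousMap.coe_mk, Prod.snd_mul, toAdd_mul, this]
    ring
  · have : m 1 = 1 := by simpa [h0, hv, ofPadic_zero] using hm 0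
    simp [γ, this]

/-- The witness is half a principal one, -y(ψ(g) - 1)/2, which is integral because units of ℤ₂ are
odd. -/
theorem exists_crossed_of_τ_eq_neg_one (hε : ψ τ = -1) (y : ℤ_[2]) :
    ∃ c ∈ crossedHoms (charRep ψ), c τ = y := by
  have h2 : ∀ g, ∃ a : ℤ_[2], (ψ g : ℤ_[2]) - 1 = 2 * a := fun g => by
    rw [← PadicInt.toZMod_eq_zero_iff_exists, map_sub, PadicInt.toZMod_unit, map_one, sub_self]
  choose a ha using h2
  have hcont : Continuous a := by
    have h1 : Continuous fun g => 2 * a g := by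
      simp_rw [← ha]
      exact (Units.continuous_val.comp (map_continuous ψ)).sub continuous_const
    -- Doubling is an embedding of a compact space, so halving preserves continuity.
    have hemb : IsClosedEmbedding fun x : ℤ_[2] => 2 * x :=
      (continuous_const.mul continuous_id).isClosedEmbedding
        (mul_right_injective₀ (two_ne_zero (α := ℤ_[2])))
    exact hemb.isInducing.continuous_iff.2 h1
  refine ⟨⟨fun g => -(a g * y), by fun_prop⟩, fun g h => ?_, ?_⟩
  · apply mul_left_cancel₀ (two_ne_zero (α := ℤ_[2]))
    have h1 := ha (g * h)
    rw [map_mul, Units.val_mul] at h1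
    simp only [ContinuousMap.coe_mk, charRep_apply]
    linear_combination (-y) * (-h1 + ha g + ψ g * ha h)
  · apply mul_left_cancel₀ (two_ne_zero (α := ℤ_[2]))
    have h1 := ha τ
    rw [hε, Units.val_neg, Units.val_one] at h1
    simp only [ContinuousMap.coe_mk]
    linear_combination y * h1

/-- Evaluation of crossed homomorphisms. -/
def evalCrossed (ψ : SignedPadic →ₜ* ℤ_[2]ˣ) (g : SignedPadic) :
    crossedHoms (charRep ψ) →ₗ[ℤ_[2]] ℤ_[2] where
  toFun c := c.1 g
  map_add' _ _ := rfl
  map_smul' _ _ := rfl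

/-- The crossed homomorphism `g ↦ g x - x`. -/
theorem principal_mem (x : ℤ_[2]) :
    (⟨fun g => ψ g * x - x, ((Units.continuous_val.comp (map_continuous ψ)).mul
      continuous_const).sub continuous_const⟩ : C(SignedPadic, ℤ_[2])) ∈
      crossedHoms (charRep ψ) := by
  intro g h
  simp only [ContinuousMap.coe_mk, charRep_apply, map_mul, Units.val_mul]
  ring

theorem evalCrossed_γ_surjective (hε : ψ τ = 1) : Function.Surjective (evalCrossed ψ γ) := by
  intro y
  obtain ⟨c, hc, hy⟩ := exists_crossed_of_τ_eq_one hε y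
  exact ⟨⟨c, hc⟩, hy⟩

theorem evalCrossed_τ_surjective (hε : ψ τ = -1) : Function.Surjective (evalCrossed ψ τ) := by
  intro y
  obtain ⟨c, hc, hy⟩ := exists_crossed_of_τ_eq_neg_one hε y
  exact ⟨⟨c, hc⟩, hy⟩

theorem crossedClass_eq_zero_iff_γ (hε : ψ τ = 1) (c : crossedHoms (charRep ψ)) :
    crossedClass (continuous_charRep ψ) c = 0 ↔ ∃ x, c.1 γ = (ψ γ - 1) * x := by
  rw [crossedClass_eq_zero_iff]
  refine exists_congr fun x => ⟨fun h => ?_, fun h g => ?_⟩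
  · rw [h, charRep_apply]
    ring
  · have := crossed_ext_of_τ_eq_one hε c.2 (principal_mem x) (by
      rw [h, ContinuousMap.coe_mk]
      ring)
    rw [this]
    rfl

theorem crossedClass_eq_zero_iff_τ (hε : ψ τ = -1) (c : crossedHoms (charRep ψ)) :
    crossedClass (continuous_charRep ψ) c = 0 ↔ ∃ x, c.1 τ = 2 * x := by
  rw [crossedClass_eq_zero_iff]
  constructor
  · rintro ⟨x, h⟩
    refine ⟨-x, ?_⟩
    rw [h, charRep_apply, hε, Units.val_neg, Units.val_one]
    ring
  · rintro ⟨x, h⟩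
    refine ⟨-x, fun g => ?_⟩
    have := crossed_ext_of_τ_eq_neg_one hε c.2 (principal_mem (-x)) (by
      rw [h, ContinuousMap.coe_mk, hε, Units.val_neg, Units.val_one]
      ring)
    rw [this]
    rfl

/-! ### The first cohomology of a character -/

theorem charH_one_of_trivial (hψ : ∀ g, ψ g = 1) : Nonempty (charH ψ 1 ≃ₗ[ℤ_[2]] ℤ_[2]) := by
  have h1 : Function.Bijective (crossedClass (continuous_charRep ψ)) := by
    refine ⟨?_, crossedClass_surjective _⟩
    rw [injective_iff_map_eq_zero]
    intro c hc
    obtain ⟨x, hx⟩ := (crossedClass_eq_zero_iff _ _).1 hc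
    ext g
    rw [hx]
    simp [hψ]
  have h2 : Function.Bijective (evalCrossed ψ γ) :=
    ⟨fun c c' h => Subtype.ext (crossed_ext_of_τ_eq_one (hψ τ) c.2 c'.2 h),
      evalCrossed_γ_surjective (hψ τ)⟩
  exact ⟨(LinearEquiv.ofBijective _ h1).symm ≪≫ₗ LinearEquiv.ofBijective _ h2⟩

/-- Evaluation at γ identifies H¹ with ℤ₂/(ψ(γ) - 1). -/
theorem charH_one_of_τ_eq_one (hε : ψ τ = 1) (n : ℕ)
    (hn : Ideal.span {((ψ γ : ℤ_[2]) - 1)} = Ideal.span {(2 : ℤ_[2]) ^ n}) :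
    Nonempty (charH ψ 1 ≃+ ZMod (2 ^ n)) := by
  refine nonempty_addEquiv_of_surjective (crossedClass (continuous_charRep ψ)).toAddMonoidHom
    (crossedClass_surjective _) ((PadicInt.toZModPow n).toAddMonoidHom.comp
      (evalCrossed ψ γ).toAddMonoidHom)
    ((ZMod.ringHom_surjective (PadicInt.toZModPow n)).comp (evalCrossed_γ_surjective hε)) fun c => ?_
  refine (crossedClass_eq_zero_iff_γ hε c).trans ?_
  change (∃ x, _ = _ * x) ↔ PadicInt.toZModPow n (c.1 γ) = 0
  rw [← RingHom.mem_ker, PadicInt.ker_toZModPow, Nat.cast_ofNat, ← hn, Ideal.mem_span_singleton]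
  rfl

theorem charH_one_of_τ_eq_neg_one (hε : ψ τ = -1) : Nonempty (charH ψ 1 ≃+ ZMod 2) := by
  refine nonempty_addEquiv_of_surjective (crossedClass (continuous_charRep ψ)).toAddMonoidHom
    (crossedClass_surjective _) ((PadicInt.toZMod (p := 2)).toAddMonoidHom.comp
      (evalCrossed ψ τ).toAddMonoidHom)
    ((PadicInt.toZMod_surjective 2).comp (evalCrossed_τ_surjective hε)) fun c => ?_
  exact (crossedClass_eq_zero_iff_τ hε c).trans PadicInt.toZMod_eq_zero_iff_exists.symm

/-! ### Higher cohomology of a character -/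

theorem crossed_sign_τ {b : C(SignedPadic, C(ℤˣ, ℤ_[2]))} (hb : b ∈ crossedHoms (signRep ψ)) :
    b τ 1 + ψ τ * b τ (-1) = 0 := by
  have h := congrArg (fun F : C(ℤˣ, ℤ_[2]) => F 1) (hb τ τ)
  simp only [τ_mul_τ, apply_one_of_mem_crossedHoms hb, ContinuousMap.add_apply, funRep_apply,
    charRep_apply, one_mul, ContinuousMap.zero_apply] at h
  exact h.symm

theorem crossed_sign_γ {b : C(SignedPadic, C(ℤˣ, ℤ_[2]))} (hb : b ∈ crossedHoms (signRep ψ)) :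
    b γ 1 + ψ γ * b τ 1 = b τ 1 + ψ τ * b γ (-1) := by
  have h1 := congrArg (fun F : C(ℤˣ, ℤ_[2]) => F 1) (hb τ γ)
  have h2 := congrArg (fun F : C(ℤˣ, ℤ_[2]) => F 1) (hb γ τ)
  simp only [ContinuousMap.add_apply, funRep_apply, charRep_apply, one_mul] at h1 h2
  have h3 : sign τ = -1 := rfl
  have h4 : sign γ = 1 := rfl
  rw [h3] at h1
  rw [h4, mul_comm γ τ] at h2
  rw [← h1, ← h2]

theorem χ_τ : χ τ = -1 := by
  ext
  simp [χ_apply, τ]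

theorem mul_χ_τ : (ψ * χ) τ = -ψ τ := by
  rw [ContinuousMonoidHom.mul_apply, χ_τ, mul_neg, mul_one]

/-- Commutation gives b(γ)(1) + b(γ)(-1) = (1 - ψ(γ)) b(τ)(1), which is even; sum and difference
have the same parity. -/
theorem toZMod_signDiff_γ (hε : ψ τ = -1) {b : C(SignedPadic, C(ℤˣ, ℤ_[2]))}
    (hb : b ∈ crossedHoms (signRep ψ)) : PadicInt.toZMod (signDiff (b γ)) = 0 := by
  have h1 := crossed_sign_γ hb
  rw [hε, Units.val_neg, Units.val_one] at h1
  obtain ⟨a, ha⟩ := PadicInt.toZMod_eq_zero_iff_exists.1 (show PadicInt.toZMod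
    ((ψ γ : ℤ_[2]) - 1) = 0 by rw [map_sub, PadicInt.toZMod_unit, map_one, sub_self])
  rw [PadicInt.toZMod_eq_zero_iff_exists]
  refine ⟨b γ 1 + a * b τ 1, ?_⟩
  rw [signDiff_apply]
  linear_combination b τ 1 * ha - h1

/-- The relation τ² = 1 makes b(τ)(1) and b(τ)(-1) opposite. -/
theorem toZMod_signDiff_τ (hε : ψ τ = 1) {b : C(SignedPadic, C(ℤˣ, ℤ_[2]))}
    (hb : b ∈ crossedHoms (signRep ψ)) : PadicInt.toZMod (signDiff (b τ)) = 0 := by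
  have h1 := crossed_sign_τ hb
  rw [hε, Units.val_one] at h1
  rw [PadicInt.toZMod_eq_zero_iff_exists]
  refine ⟨b τ 1, ?_⟩
  rw [signDiff_apply]
  linear_combination -h1

/-- The inclusion {±1} → ℤ₂ spans a copy of ψχ inside C({±1}), on which `signDiff` is multiplication
by 2. -/
theorem exists_signDiff_lift {c : C(SignedPadic, ℤ_[2])} (hc : c ∈ crossedHoms (charRep (ψ * χ))) :
    ∃ b ∈ crossedHoms (signRep ψ), ∀ g, signDiff (b g) = 2 * c g := by
  let w : C(ℤˣ, ℤ_[2]) := ⟨fun e => ((e : ℤ) : ℤ_[2]), continuous_of_discreteTopology⟩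
  refine ⟨⟨fun g => c g • w, by fun_prop⟩, fun g h => ?_, fun g => ?_⟩
  · ext e
    simp only [ContinuousMap.coe_mk, crossed_mul hc, ContinuousMap.add_apply, funRep_apply,
      ContinuousMap.smul_apply, charRep_apply, smul_eq_mul, ContinuousMonoidHom.mul_apply,
      Units.val_mul, χ_apply, w]
    change _ = _ + _ * (_ * (((e : ℤ) * (g.1 : ℤ) : ℤ) : ℤ_[2]))
    push_cast
    ring
  · simp only [signDiff_apply, ContinuousMap.coe_mk, ContinuousMap.smul_apply, w, smul_eq_mul]
    push_cast
    ring

/-- H²(ψ) is H¹(ψχ) modulo the image of H¹ of C({±1}). If ψ(τ) = 1, that image vanishes and H¹(ψχ)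
is already ℤ/2. If ψ(τ) = -1, the image consists exactly of the classes with even value at γ. -/
theorem charH_two (ψ : SignedPadic →ₜ* ℤ_[2]ˣ) : Nonempty (charH ψ 2 ≃+ ZMod 2) := by
  obtain ⟨δ, h0, hs⟩ := exists_signConnecting ψ 1
  have hδ := hs (subsingleton_signRep ψ 0)
  have key : ∀ c : crossedHoms (charRep (ψ * χ)),
      δ (crossedClass (continuous_charRep (ψ * χ)) c) = 0 ↔
      ∃ b ∈ crossedHoms (signRep ψ), ∃ x, ∀ g,
        signDiff (b g) - c.1 g = (ψ * χ) g * x - x := by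
    intro c
    rw [h0]
    constructor
    · rintro ⟨y, hy⟩
      obtain ⟨b, rfl⟩ := crossedClass_surjective (continuous_signRep ψ) y
      rw [homologyMap_crossedClass] at hy
      obtain ⟨x, hx⟩ := (crossedClass_eq_iff _ _ _).1 hy
      exact ⟨b.1, b.2, x, hx⟩
    · rintro ⟨b, hb, x, hx⟩
      refine ⟨crossedClass (continuous_signRep ψ) ⟨b, hb⟩, ?_⟩
      rw [homologyMap_crossedClass]
      exact (crossedClass_eq_iff _ _ _).2 ⟨x, hx⟩
  have hsurj : Function.Surjective (δ ∘ₗ crossedClass (continuous_charRep (ψ * χ))) :=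
    hδ.comp (crossedClass_surjective _)
  rcases character_τ ψ with hε | hε
  · have hε' : (ψ * χ) τ = -1 := by rw [mul_χ_τ, hε]
    refine nonempty_addEquiv_of_surjective
      (δ ∘ₗ crossedClass (continuous_charRep (ψ * χ))).toAddMonoidHom
      hsurj ((PadicInt.toZMod (p := 2)).toAddMonoidHom.comp
      (evalCrossed (ψ * χ) τ).toAddMonoidHom)
      ((PadicInt.toZMod_surjective 2).comp (evalCrossed_τ_surjective hε')) fun c => ?_
    refine (key c).trans ?_
    change _ ↔ PadicInt.toZMod (c.1 τ) = 0
    constructor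
    · rintro ⟨b, hb, x, hx⟩
      have h1 := toZMod_signDiff_τ hε hb
      have h2 : signDiff (b τ) = c.1 τ - 2 * x := by
        have := hx τ
        rw [hε', Units.val_neg, Units.val_one] at this
        linear_combination this
      rw [PadicInt.toZMod_eq_zero_iff_exists] at h1 ⊢
      obtain ⟨a, ha⟩ := h1
      exact ⟨a + x, by linear_combination ha - h2⟩
    · intro h
      obtain ⟨x, hx⟩ := (crossedClass_eq_zero_iff _ c).1
        ((crossedClass_eq_zero_iff_τ hε' c).2 (PadicInt.toZMod_eq_zero_iff_exists.1 h))
      -- An even value at τ makes c principal, so b = 0 serves.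
      refine ⟨0, zero_mem _, -x, fun g => ?_⟩
      rw [hx g, charRep_apply, ContinuousMap.zero_apply, map_zero]
      ring
  · have hε' : (ψ * χ) τ = 1 := by rw [mul_χ_τ, hε, neg_neg]
    refine nonempty_addEquiv_of_surjective
      (δ ∘ₗ crossedClass (continuous_charRep (ψ * χ))).toAddMonoidHom
      hsurj ((PadicInt.toZMod (p := 2)).toAddMonoidHom.comp
      (evalCrossed (ψ * χ) γ).toAddMonoidHom)
      ((PadicInt.toZMod_surjective 2).comp (evalCrossed_γ_surjective hε')) fun c => ?_
    refine (key c).trans ?_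
    change _ ↔ PadicInt.toZMod (c.1 γ) = 0
    constructor
    · rintro ⟨b, hb, x, hx⟩
      have h1 := toZMod_signDiff_γ hε hb
      have h2 : c.1 γ = signDiff (b γ) - ((ψ * χ) γ * x - x) := by
        rw [← hx γ]
        ring
      rw [h2, map_sub, h1, map_sub, map_mul, PadicInt.toZMod_unit, one_mul, sub_self, sub_self]
    · intro h
      obtain ⟨y, hy⟩ := PadicInt.toZMod_eq_zero_iff_exists.1 h
      obtain ⟨c', hc', hy'⟩ := exists_crossed_of_τ_eq_one hε' y
      obtain ⟨b, hb, hbc⟩ := exists_signDiff_lift hc'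
      have : c.1 = (2 : ℤ_[2]) • c' := by
        refine crossed_ext_of_τ_eq_one hε' c.2 (Submodule.smul_mem _ _ hc') ?_
        rw [hy, ContinuousMap.smul_apply, hy', smul_eq_mul]
      refine ⟨b, hb, 0, fun g => ?_⟩
      rw [hbc, this, ContinuousMap.smul_apply, smul_eq_mul]
      ring

theorem charH_add_two (n : ℕ) (ψ : SignedPadic →ₜ* ℤ_[2]ˣ) :
    Nonempty (charH ψ (n + 2) ≃+ ZMod 2) := by
  induction n generalizing ψ with
  | zero => exact charH_two ψ
  | succ n ih =>
    obtain ⟨e⟩ := charH_shift ψ n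
    obtain ⟨e'⟩ := ih (ψ * χ)
    exact ⟨e.symm.toAddEquiv.trans e'⟩

end SignedPadic

/-! ### The 2-adic exponential 5ˣ. -/

section Exponential

namespace PadicInt

theorem norm_two : ‖(2 : ℤ_[2])‖ = 2⁻¹ := by
  simpa using PadicInt.norm_p (p := 2)

theorem norm_four : ‖(4 : ℤ_[2])‖ = 4⁻¹ := by
  rw [show (4 : ℤ_[2]) = 2 * 2 by norm_num, norm_mul, norm_two]
  norm_num

theorem norm_one_add_two_mul (y : ℤ_[2]) : ‖1 + 2 * y‖ = 1 := by
  have h : ‖2 * y‖ < 1 := by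
    rw [norm_mul, norm_two]
    have := PadicInt.norm_le_one y
    linarith
  rw [PadicInt.norm_add_eq_max_of_ne (by rw [norm_one]; exact h.ne'), norm_one]
  exact max_eq_left h.le

theorem associated_of_norm_eq {p : ℕ} [Fact p.Prime] {x y : ℤ_[p]} (h : ‖x‖ = ‖y‖) :
    Associated x y := by
  rcases eq_or_ne y 0 with rfl | hy
  · rw [norm_zero, norm_eq_zero] at h
    rw [h]
  · have hx : x ≠ 0 := by
      rw [← norm_ne_zero_iff, h]
      exact norm_ne_zero_iff.2 hy
    have hv : x.valuation = y.valuation := by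
      rw [PadicInt.norm_eq_zpow_neg_valuation hx, PadicInt.norm_eq_zpow_neg_valuation hy] at h
      have := zpow_right_injective₀ (by exact_mod_cast (Fact.out : p.Prime).pos)
        (by exact_mod_cast (Fact.out : p.Prime).ne_one) h
      omega
    have ax : Associated ((p : ℤ_[p]) ^ x.valuation) x :=
      ⟨unitCoeff hx, by rw [mul_comm]; exact (unitCoeff_spec hx).symm⟩
    have ay : Associated ((p : ℤ_[p]) ^ y.valuation) y :=
      ⟨unitCoeff hy, by rw [mul_comm]; exact (unitCoeff_spec hy).symm⟩
    rw [hv] at ax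
    exact ax.symm.trans ay

theorem norm_five_pow_sub_one (n : ℕ) : ‖(5 : ℤ_[2]) ^ n - 1‖ = ‖(n : ℤ_[2])‖ / 4 := by
  induction n using Nat.strong_induction_on with
  | _ n ih =>
    obtain ⟨j, rfl | rfl⟩ := Nat.even_or_odd' n
    · rcases Nat.eq_zero_or_pos j with rfl | hj
      · simp
      · obtain ⟨a, ha⟩ : ((5 : ℤ_[2]) - 1) ∣ 5 ^ j - 1 ^ j := sub_dvd_pow_sub_pow _ _ _
        -- With 5ʲ - 1 = 4a, the factor 5ʲ + 1 is twice an odd number, so doubling the exponent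
        -- halves the norm.
        have h1 : (5 : ℤ_[2]) ^ (2 * j) - 1 = (5 ^ j - 1) * (2 * (1 + 2 * a)) := by
          rw [mul_comm 2 j, pow_mul]
          rw [one_pow] at ha
          linear_combination (5 ^ j - 1) * ha
        rw [h1, norm_mul, norm_mul, norm_one_add_two_mul, ih j (by omega), Nat.cast_mul, norm_mul,
          Nat.cast_ofNat, norm_two]
        ring
    · obtain ⟨a, ha⟩ : ((5 : ℤ_[2]) ^ 2 - 1) ∣ (5 ^ 2) ^ j - 1 ^ j := sub_dvd_pow_sub_pow _ _ _
      -- Here 25ʲ - 1 = 24a, hence 5·25ʲ - 1 = 4 + 120a.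
      have h1 : (5 : ℤ_[2]) ^ (2 * j + 1) - 1 = 4 * (1 + 2 * (15 * a)) := by
        rw [pow_succ, pow_mul]
        rw [one_pow] at ha
        linear_combination 5 * ha
      have h2 : ((2 * j + 1 : ℕ) : ℤ_[2]) = 1 + 2 * j := by push_cast; ring
      rw [h1, h2, norm_mul, norm_one_add_two_mul, norm_one_add_two_mul, norm_four]
      norm_num

/-- The exponential function `x ↦ 5ˣ` on the `2`-adic integers. -/
def expFive : AddChar ℤ_[2] ℤ_[2] :=
  -- The parameter is the value at 1 minus 1.
  addChar_of_value_at_one 4 (tendsto_pow_atTop_nhds_zero_iff_norm_lt_one.2 (by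
    rw [norm_four]; norm_num))

@[fun_prop]
theorem continuous_expFive : Continuous expFive := continuous_addChar_of_value_at_one _

theorem expFive_one : expFive 1 = 5 := by
  rw [expFive, addChar_of_value_at_one_def]
  norm_num

theorem expFive_natCast (n : ℕ) : expFive n = 5 ^ n := by
  rw [← expFive_one, ← AddChar.map_nsmul_eq_pow, nsmul_one]

theorem norm_expFive_sub_one (x : ℤ_[2]) : ‖expFive x - 1‖ = ‖x‖ / 4 := by
  refine congrFun (PadicInt.denseRange_natCast.equalizer (g := fun x => ‖expFive x - 1‖)
    (h := fun x => ‖x‖ / 4) (by fun_prop) (by fun_prop) (funext fun n => ?_)) x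
  simp [expFive_natCast, norm_five_pow_sub_one]

/-- Powers 5ⁿ approximate a: when 2ᵏ⁺² divides a - 5ⁿ with odd quotient, adding 2ᵏ to n gains a
digit, because 5^(2ᵏ) - 1 is 2ᵏ⁺² times a unit. The range is compact, hence closed. -/
theorem exists_expFive_eq {a : ℤ_[2]} (ha : (4 : ℤ_[2]) ∣ a - 1) : ∃ x, expFive x = a := by
  have happrox : ∀ k : ℕ, ∃ n : ℕ, (2 : ℤ_[2]) ^ (k + 2) ∣ a - 5 ^ n := by
    intro k
    induction k with
    | zero => exact ⟨0, by norm_num; exact ha⟩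
    | succ k ih =>
      obtain ⟨n, b, hb⟩ := ih
      have hne : PadicInt.toZMod b = 0 ∨ PadicInt.toZMod b = 1 := by
        generalize PadicInt.toZMod b = z
        revert z
        decide
      rcases hne with h | h
      · obtain ⟨c, rfl⟩ := PadicInt.toZMod_eq_zero_iff_exists.1 h
        exact ⟨n, c, by rw [hb]; ring⟩
      · have hass : Associated ((2 : ℤ_[2]) ^ (k + 2)) (5 ^ 2 ^ k - 1) := by
          apply associated_of_norm_eq
          rw [norm_five_pow_sub_one, norm_pow, norm_two, Nat.cast_pow, norm_pow, Nat.cast_ofNat,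
            norm_two]
          ring
        obtain ⟨w, hw⟩ := hass
        have h5 : PadicInt.toZMod ((5 : ℤ_[2]) ^ n) = 1 := by
          rw [map_pow, show (5 : ℤ_[2]) = ((5 : ℕ) : ℤ_[2]) by norm_num, map_natCast]
          rw [show ((5 : ℕ) : ZMod 2) = 1 from rfl, one_pow]
        obtain ⟨c, hc⟩ := PadicInt.toZMod_eq_zero_iff_exists.1
          (show PadicInt.toZMod (b - 5 ^ n * (w : ℤ_[2])) = 0 by
            rw [map_sub, map_mul, h, h5, PadicInt.toZMod_unit, one_mul, sub_self])
        refine ⟨n + 2 ^ k, c, ?_⟩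
        rw [pow_add]
        linear_combination hb + 5 ^ n * hw + 2 ^ (k + 2) * hc
  have hcl : IsClosed (Set.range expFive) := (isCompact_range continuous_expFive).isClosed
  have : a ∈ closure (Set.range expFive) := by
    rw [Metric.mem_closure_iff]
    intro ε hε
    obtain ⟨k, hk⟩ := PadicInt.exists_pow_neg_lt 2 hε
    obtain ⟨n, c, hc⟩ := happrox k
    refine ⟨_, ⟨n, rfl⟩, lt_of_le_of_lt ?_ hk⟩
    rw [dist_eq_norm, expFive_natCast, hc, norm_mul, pow_add, norm_mul, norm_pow, norm_two, zpow_neg,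
      zpow_natCast, Nat.cast_ofNat, ← inv_pow]
    have h1 := PadicInt.norm_le_one c
    have h2 := PadicInt.norm_le_one ((2 : ℤ_[2]) ^ 2)
    calc _ ≤ (2⁻¹ : ℝ) ^ k * 1 * 1 := by gcongr
      _ = _ := by ring
  rwa [hcl.closure_eq] at this

/-- The exponential function `x ↦ 5ˣ` with values in units. -/
def expFiveUnits : Multiplicative ℤ_[2] →ₜ* ℤ_[2]ˣ where
  toMonoidHom := expFive.toMonoidHom.toHomUnits
  continuous_toFun := by
    rw [Units.continuous_iff]
    constructor
    · exact continuous_expFive.comp continuous_toAdd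
    · have : (fun x : Multiplicative ℤ_[2] => ((expFive.toMonoidHom.toHomUnits x)⁻¹).val) =
          fun x => expFive (x⁻¹).toAdd := by
        ext x
        rw [← map_inv]
        rfl
      change Continuous fun x : Multiplicative ℤ_[2] =>
        ((expFive.toMonoidHom.toHomUnits x)⁻¹).val
      rw [this]
      exact continuous_expFive.comp (continuous_toAdd.comp continuous_inv)

end PadicInt

end Exponential

/-! ### The isomorphism {±1} × ℤ₂ ≅ ℤ₂ˣ. -/

namespace SignedPadic

open PadicInt

/-- The homomorphism `(e, x) ↦ e 5ˣ`. -/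
def toUnits : SignedPadic →ₜ* ℤ_[2]ˣ := χ * expFiveUnits.comp (.snd _ _)

theorem toUnits_ofPadic (x : ℤ_[2]) : (toUnits (ofPadic x) : ℤ_[2]) = expFive x := by
  rw [toUnits, ContinuousMonoidHom.mul_apply, Units.val_mul, χ_apply]
  simp only [ofPadic, Units.val_one, Int.cast_one, one_mul]
  rfl

theorem toUnits_τ : toUnits τ = -1 := by
  rw [toUnits, ContinuousMonoidHom.mul_apply, χ_τ]
  change -1 * expFiveUnits 1 = -1
  rw [map_one, mul_one]

theorem toUnits_injective : Function.Injective toUnits := by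
  rw [injective_iff_map_eq_one]
  intro g hg
  have hg := congrArg Units.val hg
  obtain ⟨x, rfl | rfl⟩ := eq_ofPadic_or g
  · rw [toUnits_ofPadic, Units.val_one] at hg
    have := norm_expFive_sub_one x
    rw [hg, sub_self, norm_zero] at this
    have hx : x = 0 := by
      rw [← norm_eq_zero]
      linarith
    rw [hx, ofPadic_zero]
  · rw [map_mul, toUnits_τ, Units.val_mul, toUnits_ofPadic, Units.val_neg, Units.val_one] at hg
    have := norm_expFive_sub_one x
    -- -5ˣ = 1 would force |5ˣ - 1| = 1/2, but this norm is at most 1/4.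
    rw [show expFive x - 1 = -2 by linear_combination -hg, norm_neg, norm_two] at this
    have := PadicInt.norm_le_one x
    norm_num at *
    linarith

/-- For an odd a, one of a and -a is 1 modulo 4, hence a power of 5. -/
theorem toUnits_surjective : Function.Surjective toUnits := by
  intro a
  obtain ⟨b, hb⟩ := PadicInt.toZMod_eq_zero_iff_exists.1 (show PadicInt.toZMod
    ((a : ℤ_[2]) - 1) = 0 by rw [map_sub, PadicInt.toZMod_unit, map_one, sub_self])
  have hne : PadicInt.toZMod b = 0 ∨ PadicInt.toZMod (1 + b) = 0 := by
    rw [map_add, map_one]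
    generalize PadicInt.toZMod b = z
    revert z
    decide
  rcases hne with h | h
  · obtain ⟨c, hc⟩ := PadicInt.toZMod_eq_zero_iff_exists.1 h
    obtain ⟨x, hx⟩ := exists_expFive_eq (a := a) ⟨c, by linear_combination hb + 2 * hc⟩
    exact ⟨ofPadic x, Units.ext (by rw [toUnits_ofPadic, hx])⟩
  · obtain ⟨c, hc⟩ := PadicInt.toZMod_eq_zero_iff_exists.1 h
    obtain ⟨x, hx⟩ := exists_expFive_eq (a := -a) ⟨-c, by linear_combination -hb - 2 * hc⟩
    refine ⟨τ * ofPadic x, Units.ext ?_⟩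
    rw [map_mul, toUnits_τ, Units.val_mul, toUnits_ofPadic, hx]
    simp

/-- `{±1} × ℤ₂ ≃ ℤ₂ˣ` as topological groups. -/
def unitsEquiv : SignedPadic ≃ₜ* ℤ_[2]ˣ :=
  let e := MulEquiv.ofBijective toUnits ⟨toUnits_injective, toUnits_surjective⟩
  { e with
    continuous_toFun := map_continuous toUnits
    continuous_invFun := (Continuous.homeoOfEquivCompactToT2 (f := e.toEquiv)
      (map_continuous toUnits)).continuous_symm }

theorem unitsEquiv_apply (g : SignedPadic) : unitsEquiv g = toUnits g := rfl

/-- The character through which `{±1} × ℤ₂` acts on `E_{2n}`. -/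
def unitsPow (n : ℤ) : SignedPadic →ₜ* ℤ_[2]ˣ where
  toMonoidHom := (zpowGroupHom n).comp toUnits.toMonoidHom
  continuous_toFun := (map_continuous toUnits).zpow n

theorem unitsPow_apply (n : ℤ) (g : SignedPadic) : unitsPow n g = toUnits g ^ n := rfl

theorem unitsPow_γ (n : ℤ) : (unitsPow n γ : ℤ_[2]) = expFive n := by
  rw [unitsPow_apply, ← map_zpow, ← toUnits_ofPadic]
  congr 2
  simp [γ, ofPadic, ← ofAdd_zsmul]

theorem norm_unitsPow_γ_sub_one (n : ℤ) : ‖(unitsPow n γ : ℤ_[2]) - 1‖ = ‖(n : ℤ_[2])‖ / 4 := by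
  rw [unitsPow_γ, norm_expFive_sub_one]

theorem unitsPow_τ_of_even {n : ℤ} (h : Even n) : unitsPow n τ = 1 := by
  rw [unitsPow_apply, toUnits_τ, h.neg_one_zpow]

theorem unitsPow_τ_of_odd {n : ℤ} (h : Odd n) : unitsPow n τ = -1 := by
  rw [unitsPow_apply, toUnits_τ, h.neg_one_zpow]

end SignedPadic

/-! ### Translation back to the modules E_t. -/

section Morava

open SignedPadic

/-- The generator `u⁻ⁿ` identifies `E_{2n}` with `ℤ₂`. -/
def moravaELinearEquiv (n : ℤ) : MoravaE (2 * n) ≃ₗ[ℤ_[2]] ℤ_[2] where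
  toFun f := f.1.coeff (-n)
  map_add' f f' := by simp
  map_smul' r f := by simp
  invFun r := ⟨C r * T (-n), by
    intro i hi
    rw [← single_eq_C_mul_T, AddMonoidAlgebra.coeff_single, Finsupp.single_apply] at hi
    have : -n = i := by
      by_contra h
      exact hi (if_neg h)
    omega⟩
  left_inv f := by
    refine Subtype.ext (LaurentPolynomial.ext fun i => ?_)
    change (C (f.1.coeff (-n)) * T (-n)).coeff i = f.1.coeff i
    rw [← single_eq_C_mul_T, AddMonoidAlgebra.coeff_single, Finsupp.single_apply]
    split_ifs with h
    · rw [h]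
    · by_contra h'
      have := f.2 i (Ne.symm h')
      omega
  right_inv r := by
    change (C r * T (-n)).coeff (-n) = r
    rw [← single_eq_C_mul_T, AddMonoidAlgebra.coeff_single, Finsupp.single_apply, if_pos rfl]

theorem Ideal.pow_smul_top_mem_nhds_zero {R : Type*} [CommRing R] (I : Ideal R) (M : Type*)
    [AddCommGroup M] [Module R M] (k : ℕ) :
    ((I ^ k • (⊤ : Submodule R M) : Submodule R M) : Set M) ∈
      @nhds M (I.adicModuleTopology M) 0 := by
  let := I.adicTopology
  exact (I.ringFilterBasis.moduleFilterBasis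
    (I.adic_module_basis M)).toAddGroupFilterBasis.mem_nhds_zero ⟨k, rfl⟩

/-- A linear map sends 𝔪ᵏE_t into 𝔪ᵏ. -/
theorem continuous_linearMap_moravaE {t : ℤ} (φ : MoravaE t →ₗ[ℤ_[2]] ℤ_[2]) : Continuous φ := by
  refine continuous_of_continuousAt_zero φ ?_
  rw [ContinuousAt, map_zero, padicInt_isAdic.hasBasis_nhds_zero.tendsto_right_iff]
  intro k _
  have h : ((IsLocalRing.maximalIdeal ℤ_[2] ^ k • (⊤ : Submodule ℤ_[2] (MoravaE t)) :
      Submodule ℤ_[2] (MoravaE t)) : Set (MoravaE t)) ∈ 𝓝 (0 : MoravaE t) :=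
    (IsLocalRing.maximalIdeal ℤ_[2]).pow_smul_top_mem_nhds_zero (MoravaE t) k
  filter_upwards [h] with x hx
  have h1 : φ x ∈ Submodule.map φ (IsLocalRing.maximalIdeal ℤ_[2] ^ k • ⊤) :=
    Submodule.mem_map_of_mem hx
  rw [Submodule.map_smul''] at h1
  have h2 : IsLocalRing.maximalIdeal ℤ_[2] ^ k • Submodule.map φ ⊤ ≤
      IsLocalRing.maximalIdeal ℤ_[2] ^ k :=
    Submodule.smul_le.2 fun r hr y _ => Ideal.mul_mem_right y _ hr
  exact h2 h1

/-- `E_{2n}` is isomorphic to `ℤ₂` as a topological module. -/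
def moravaEEquiv (n : ℤ) : MoravaE (2 * n) ≃L[ℤ_[2]] ℤ_[2] where
  toLinearEquiv := moravaELinearEquiv n
  continuous_toFun := continuous_linearMap_moravaE (moravaELinearEquiv n).toLinearMap
  continuous_invFun := by
    have : ∀ r, (moravaELinearEquiv n).symm r = r • (moravaELinearEquiv n).symm 1 := fun r => by
      rw [← map_smul, smul_eq_mul, mul_one]
    exact (continuous_id.smul continuous_const).congr fun r => (this r).symm

/-- The cohomology of `E_{2n}` as cohomology of a character of `{±1} × ℤ₂`. -/
def moravaHcEquiv (s : ℕ) (n : ℤ) : MoravaHc s (2 * n) ≃ₗ[ℤ_[2]] charH (unitsPow n) s :=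
  contCohomologyEquiv (moravaRep_continuous (2 * n)) (continuous_charRep (unitsPow n)) unitsEquiv
    (moravaEEquiv n) (fun g x => by
      rw [moravaRep_apply, map_smul, charRep_apply, smul_eq_mul, unitsPow_apply, unitsEquiv_apply,
        show 2 * n / 2 = n by omega]) s

theorem subsingleton_moravaE_of_odd {t : ℤ} (ht : Odd t) : Subsingleton (MoravaE t) := by
  refine subsingleton_of_forall_eq 0 fun f => Subtype.ext (LaurentPolynomial.ext fun i => ?_)
  by_contra h
  have := f.2 i h
  obtain ⟨j, rfl⟩ := ht
  omega

/-- An invariant is killed by 5ⁿ - 1, which has norm |n|/4 ≠ 0. -/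
theorem subsingleton_moravaHc_zero {n : ℤ} (hn : n ≠ 0) :
    Subsingleton (MoravaHc 0 (2 * n)) := by
  suffices Subsingleton (charRep (unitsPow n)).invariants from
    ((moravaHcEquiv 0 n).trans (contCohomologyZeroEquiv _)).injective.subsingleton
  refine subsingleton_of_forall_eq 0 fun x => Subtype.ext ?_
  have h1 : ((unitsPow n γ : ℤ_[2]) - 1) * x.1 = 0 := by
    have := x.2 γ
    rw [charRep_apply] at this
    linear_combination this
  refine (mul_eq_zero.1 h1).resolve_left fun h => hn ?_
  have h2 := norm_unitsPow_γ_sub_one n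
  rw [h, norm_zero] at h2
  have : ‖(n : ℤ_[2])‖ = 0 := by linarith
  exact_mod_cast norm_eq_zero.1 this

theorem unitsPow_zero_apply (g : SignedPadic) : unitsPow 0 g = 1 := by
  rw [unitsPow_apply, zpow_zero]

theorem nonempty_moravaHc_zero_zero : Nonempty (MoravaHc 0 (2 * 0) ≃ₗ[ℤ_[2]] ℤ_[2]) := by
  have h : (charRep (unitsPow 0)).invariants = ⊤ := by
    refine eq_top_iff.2 fun x _ g => ?_
    rw [charRep_apply, unitsPow_zero_apply, Units.val_one, one_mul]
  exact ⟨moravaHcEquiv 0 0 ≪≫ₗ contCohomologyZeroEquiv _ ≪≫ₗ LinearEquiv.ofTop _ h⟩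

theorem span_unitsPow_γ_sub_one (k : ℕ) {m : ℤ} (hm : Odd m) :
    Ideal.span {(unitsPow (2 ^ k * m) γ : ℤ_[2]) - 1} = Ideal.span {(2 : ℤ_[2]) ^ (k + 2)} := by
  rw [Ideal.span_singleton_eq_span_singleton]
  apply PadicInt.associated_of_norm_eq
  obtain ⟨j, rfl⟩ := hm
  rw [norm_unitsPow_γ_sub_one]
  push_cast
  rw [add_comm (2 * (j : ℤ_[2])), norm_mul, PadicInt.norm_one_add_two_mul, norm_pow, norm_pow,
    PadicInt.norm_two]
  ring

end Morava

end

theorem theorem6p4 (s : ℕ) (t : ℤ) :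
    (t = 0 ∧ (s = 0 ∨ s = 1) → Nonempty (MoravaHc s t ≃ₗ[ℤ_[2]] ℤ_[2])) ∧
    (∀ (k : ℕ) (m : ℤ), t = 2 ^ (k + 1) * m → Odd m → k ≠ 0 → s = 1 →
      Nonempty (MoravaHc s t ≃+ ZMod (2 ^ (k + 2)))) ∧
    ((∃ t' : ℤ, t = 4 * t' + 2) ∧ s = 1 → Nonempty (MoravaHc s t ≃+ ZMod 2)) ∧
    (2 ≤ s ∧ Even t → Nonempty (MoravaHc s t ≃+ ZMod 2)) ∧
    (¬ (t = 0 ∧ (s = 0 ∨ s = 1)) →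
      ¬ (∃ (k : ℕ) (m : ℤ), t = 2 ^ (k + 1) * m ∧ Odd m ∧ k ≠ 0 ∧ s = 1) →
      ¬ ((∃ t' : ℤ, t = 4 * t' + 2) ∧ s = 1) →
      ¬ (2 ≤ s ∧ Even t) →
      Subsingleton (MoravaHc s t)) := by
  refine ⟨?_, ?_, ?_, ?_, ?_⟩
  · rintro ⟨rfl, rfl | rfl⟩
    · exact nonempty_moravaHc_zero_zero
    · obtain ⟨e⟩ := SignedPadic.charH_one_of_trivial unitsPow_zero_apply
      exact ⟨moravaHcEquiv 1 0 ≪≫ₗ e⟩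
  · rintro k m rfl hm hk rfl
    obtain ⟨e⟩ := SignedPadic.charH_one_of_τ_eq_one
      (SignedPadic.unitsPow_τ_of_even ((even_two.pow_of_ne_zero hk).mul_right m)) (k + 2)
      (span_unitsPow_γ_sub_one k hm)
    rw [pow_succ', mul_assoc]
    exact ⟨(moravaHcEquiv 1 (2 ^ k * m)).toAddEquiv.trans e⟩
  · rintro ⟨⟨t', rfl⟩, rfl⟩
    obtain ⟨e⟩ := SignedPadic.charH_one_of_τ_eq_neg_one
      (SignedPadic.unitsPow_τ_of_odd (odd_two_mul_add_one t'))
    rw [show 4 * t' + 2 = 2 * (2 * t' + 1) by ring]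
    exact ⟨(moravaHcEquiv 1 (2 * t' + 1)).toAddEquiv.trans e⟩
  · rintro ⟨hs, ht⟩
    obtain ⟨n, rfl⟩ := even_iff_exists_two_mul.1 ht
    obtain ⟨s, rfl⟩ := Nat.exists_eq_add_of_le' hs
    obtain ⟨e⟩ := SignedPadic.charH_add_two s (SignedPadic.unitsPow n)
    exact ⟨(moravaHcEquiv (s + 2) n).toAddEquiv.trans e⟩
  · intro h1 h2 h3 h4
    rcases Int.even_or_odd t with ht | ht
    · obtain ⟨n, rfl⟩ := even_iff_exists_two_mul.1 ht
      have hs : s < 2 := by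
        by_contra hs
        exact h4 ⟨not_lt.1 hs, ht⟩
      have hn : n ≠ 0 := by
        rintro rfl
        exact h1 ⟨rfl, by omega⟩
      interval_cases s
      · exact subsingleton_moravaHc_zero hn
      · exfalso
        -- Write n = 2ᵏm with m odd: k = 0 means t ≡ 2 mod 4, and k ≥ 1 is the cyclic case, so
        -- nothing is left in degree one.
        obtain ⟨m, hkm, hm⟩ := (Int.finiteMultiplicity_iff (a := 2).2
          ⟨by decide, hn⟩).exists_eq_pow_mul_and_not_dvd
        rw [← even_iff_two_dvd, Int.not_even_iff_odd] at hm
        generalize multiplicity 2 n = k at hkm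
        subst hkm
        rcases Nat.eq_zero_or_pos k with rfl | hk
        · obtain ⟨j, rfl⟩ := hm
          exact h3 ⟨⟨j, by ring⟩, rfl⟩
        · exact h2 ⟨k, m, by ring, hm, hk.ne', rfl⟩
    · have := subsingleton_moravaE_of_odd ht
      exact subsingleton_contCohomology_of_subsingleton _ s
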